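/- For $k>0$ and $\mathbf x=(x,y)\neq\mathbf x'=(x',y')$ in $\mathbb R^2$ let $$G(\mathbf x,\mathbf x')=\frac k4\Big(\mathrm i H^{(1)}_0(k|\mathbf x-\mathbf x'|)\,I+H^{(1)}_1(k|\mathbf x-\mathbf x'|)\Big(\tfrac{x-x'}{|\mathbf x-\mathbf x'|}\beta+\tfrac{y-y'}{|\mathbf x-\mathbf x'|}\alpha\Big)\Big),\qquad \alpha=\begin{pmatrix}0&1\\1&0\end{pmatrix},\quad \beta=\begin{pmatrix}1&0\\0&-1\end{pmatrix},$$ where $H^{(1)}_n=J_n+\mathrm iY_n$ are the Hankel functions of the first kind, and for a measurable set $\Omega\subset\mathbb R^2$ put $$\mu_a=k\,\sup_{\mathbf x\in\Omega}\int_\Omega\|G(\mathbf x,\mathbf x')\|_1\,d\mathbf x',$$ where $\|\cdot\|_1$ is the matrix norm induced by the $\ell^1$ norm (maximal column sum). With $\gamma$ Euler's constant, define $$I(k)=\begin{cases}\pi+2\left(\gamma+\log\frac k2-\frac12\right)+\frac{8}{k^2}e^{-2\gamma},& k\ge 2e^{-\gamma},\\ (\pi+1)-2\gamma-2\log\frac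 k2,& k<2e^{-\gamma},\end{cases}$$ $$A(k,R)=\frac43\sqrt{\frac{2\pi}{k}}\,\big(R^{3/2}-1\big),\qquad B(k,R)=\frac{2\pi^2k}{3}\left(\Big(\frac{2}{\pi k}R+\frac{4}{\pi^2k^2}\Big)^{3/2}-\Big(\frac{2}{\pi k}\Big)^{3}\right).$$ Let $k>0$, $R>1$ and let $\Omega\subset\mathbb R^2$ be measurable. 1. If $\Omega$ is contained in the closed disk of radius $R$ about each of its own points (for example, if $\Omega=[0,L_x]\times[0,L_y]$ and $R=\sqrt{L_x^2+L_y^2}$), then $$\mu_a\le\frac{k^2}{4}\big(I(k)+A(k,R)+B(k,R)\big).$$ 2. If $\Omega$ is contained in some closed disk of radius $R$, with arbitrary center, then $$\mu_a\le\frac{k^2}{4}\big(I(k)+A(k,R)+\sqrt2\,B(k,R)\big).$$ -/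

import Mathlib

open MeasureTheory

noncomputable section

/-- The digamma function at the positive integer `m + 1`: `ψ(m+1) = 1 + 1/2 + ⋯ + 1/m - γ`. -/
def digammaSucc (m : ℕ) : ℝ :=
  (harmonic m : ℝ) - Real.eulerMascheroniConstant

/-- The Bessel function `J_n` of the first kind, of order `n ∈ ℕ`, on the real line. -/
def besselJ (n : ℕ) (x : ℝ) : ℝ :=
  ∑' m : ℕ, (-1 : ℝ) ^ m / ((m.factorial : ℝ) * ((m + n).factorial : ℝ)) * (x / 2) ^ (2 * m + n)

/-- The Bessel function `Y_n` of the second kind, of order `n ∈ ℕ`, for `x > 0`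
(Neumann's expansion). -/
def besselY (n : ℕ) (x : ℝ) : ℝ :=
  (2 / Real.pi) * Real.log (x / 2) * besselJ n x
    - (1 / Real.pi) * ∑ m ∈ Finset.range n,
        ((n - m - 1).factorial : ℝ) / (m.factorial : ℝ) * ((x / 2) ^ (2 * m) / (x / 2) ^ n)
    - (1 / Real.pi) * ∑' m : ℕ,
        (-1 : ℝ) ^ m * (digammaSucc m + digammaSucc (m + n)) /
          ((m.factorial : ℝ) * ((m + n).factorial : ℝ)) * (x / 2) ^ (2 * m + n)

/-- The Hankel function `H_n^{(1)} = J_n + i Y_n` of the first kind, for `x > 0`. -/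
def hankel1 (n : ℕ) (x : ℝ) : ℂ :=
  (besselJ n x : ℂ) + Complex.I * (besselY n x : ℂ)

/-- The Pauli matrix `α`. -/
def pauliAlpha : Matrix (Fin 2) (Fin 2) ℂ := !![0, 1; 1, 0]

/-- The Pauli matrix `β`. -/
def pauliBeta : Matrix (Fin 2) (Fin 2) ℂ := !![1, 0; 0, -1]

/-- The outgoing Green's function `G(x, x')` of the Dirac operator `iβ∂ₓ + iα∂_y - k` on the plane
(its value on the diagonal `x = x'` is immaterial). -/
def diracGreen (k : ℝ) (x x' : EuclideanSpace ℝ (Fin 2)) : Matrix (Fin 2) (Fin 2) ℂ :=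
  ((k / 4 : ℝ) : ℂ) •
    ((Complex.I * hankel1 0 (k * dist x x')) • (1 : Matrix (Fin 2) (Fin 2) ℂ) +
      hankel1 1 (k * dist x x') •
        ((((x 0 - x' 0) / dist x x' : ℝ) : ℂ) • pauliBeta +
          (((x 1 - x' 1) / dist x x' : ℝ) : ℂ) • pauliAlpha))

/-- The matrix norm induced by the `ℓ¹` norm, i.e. the maximal column sum, as an extended
nonnegative real. -/
def matrixOneNorm (A : Matrix (Fin 2) (Fin 2) ℂ) : ENNReal :=
  ⨆ j, ∑ i, ‖A i j‖ₑ

/-- `μ_a = k sup_{x ∈ Ω} ∫_Ω ‖G(x, x')‖₁ dx'`, with values in `[0, ∞]`. -/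
def muA (k : ℝ) (Ω : Set (EuclideanSpace ℝ (Fin 2))) : ENNReal :=
  ENNReal.ofReal k * ⨆ x ∈ Ω, ∫⁻ x' in Ω, matrixOneNorm (diracGreen k x x')

/-- The piecewise term `I(k)`. -/
def termI (k : ℝ) : ℝ :=
  if 2 * Real.exp (-Real.eulerMascheroniConstant) ≤ k then
    Real.pi + 2 * (Real.eulerMascheroniConstant + Real.log (k / 2) - 1 / 2)
      + 8 / k ^ 2 * Real.exp (-2 * Real.eulerMascheroniConstant)
  else
    (Real.pi + 1) - 2 * Real.eulerMascheroniConstant - 2 * Real.log (k / 2)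

/-- The term of order `R^{3/2} / √k`. -/
def termH0 (k R : ℝ) : ℝ :=
  4 / 3 * Real.sqrt (2 * Real.pi / k) * (R ^ (3 / 2 : ℝ) - 1)

/-- The term coming from `H_1^{(1)}`. -/
def termH1 (k R : ℝ) : ℝ :=
  2 * Real.pi ^ 2 * k / 3 *
    ((2 / (Real.pi * k) * R + 4 / (Real.pi ^ 2 * k ^ 2)) ^ (3 / 2 : ℝ) - (2 / (k * Real.pi)) ^ 3)

end

open Filter Topology

/-! Each column sum of the Green's matrix is at most `k/4 · (|H₀| + (|u| + |v|) |H₁|)`, where `(u,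
v)` is a unit vector, so `|u| + |v| ≤ √2`. The theorem thus rests on modulus bounds for `H₀` and
`H₁` and on the integration of decreasing radial functions over `Ω`.

Modulus bounds. Both functions are expressed through the Laplace integrals `Lⱼ(x) = ∫₀^∞ wʲ e^{-xw²}
(w² - 2i)^{-1/2} dw`: with `c = (4i/π) e^{ix}` one has `H₀ = -c L₀` and `H₁ = c (i L₀ - L₂)`. This
is `hankel1_eq_laplace`: both sides solve the system `D' = -D₁`, `(x D₁)' = x D` with the same
behaviour at `0⁺`, and an energy argument (`eq_zero_of_bessel_system`) gives uniqueness. Since `|w²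
- 2i| ≥ 2`, it follows that `|H₀(x)| ≤ √(2/(πx))`. As `i L₀` is orthogonal to `L₀` in the plane,
`⟨H₁, H₀⟩ = (4/π)² ⟨L₂, L₀⟩ ≤ 1/(πx²)`; hence `(x²|H₁|²)' ≤ 2/π`, and integration from the limit
`4/π²` at `0⁺` yields `norm_hankel1_one_le`. Near the origin `H₀` is also bounded by `1 +
(2/π)|log(x/2) + γ|`.

Geometry. The majorants decrease in `r`, so their integral over `Ω` is at most that over a disk
about `x` of area at least that of `Ω` (`setLIntegral_dist_le_closedBall`); only the area of `Ω`
matters. Polar coordinates turn the logarithmic bound on `[0, 1]` into `I(k)`, the square-root bound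
on `[1, R]` into `A`, and the bound for `H₁` into `B`.

Part 2 uses area at most `πR²`. In part 1, `Ω` lies in a square of side `R`, so its area is at most
`R² ≤ π (R/√2)²`, and the `H₁` term becomes `√2 B(k, R/√2)`. Since `B` is convex in `R` and vanishes
at `0`, this is at most `B(k, R)`: the factor `√2` is absorbed. -/

/-! ### Power series with factorially decaying coefficients -/

/-- The coefficients `a m` are `O(1 / m!)`. -/
def FactorialDecay (a : ℕ → ℝ) : Prop :=
  ∃ C : ℝ, ∀ m, |a m| ≤ C / m.factorial

/-- The sum of the power series with coefficients `a`. -/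
noncomputable def seriesSum (a : ℕ → ℝ) (y : ℝ) : ℝ := ∑' m, a m * y ^ m

theorem FactorialDecay.summable_abs {a : ℕ → ℝ} (ha : FactorialDecay a) (y : ℝ) :
    Summable fun m => |a m * y ^ m| := by
  obtain ⟨C, hC⟩ := ha
  refine Summable.of_nonneg_of_le (fun m => abs_nonneg _) (fun m => ?_)
    ((Real.summable_pow_div_factorial |y|).mul_left C)
  rw [abs_mul, abs_pow]
  calc |a m| * |y| ^ m ≤ C / m.factorial * |y| ^ m := by gcongr; exact hC m
    _ = C * (|y| ^ m / m.factorial) := by ring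

theorem FactorialDecay.summable {a : ℕ → ℝ} (ha : FactorialDecay a) (y : ℝ) :
    Summable fun m => a m * y ^ m :=
  (ha.summable_abs y).of_abs

/-- The factor `m + 1` cancels against `(m + 1)! = (m + 1) m!`, so the class is closed under
termwise differentiation with the same constant. -/
theorem FactorialDecay.derivCoeff {a : ℕ → ℝ} (ha : FactorialDecay a) :
    FactorialDecay fun m => (m + 1) * a (m + 1) := by
  obtain ⟨C, hC⟩ := ha
  refine ⟨C, fun m => ?_⟩
  have h := hC (m + 1)
  have hm : (0 : ℝ) < m.factorial := by positivity
  rw [Nat.factorial_succ, Nat.cast_mul, le_div_iff₀ (by positivity)] at h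
  rw [abs_mul, le_div_iff₀ hm, abs_of_pos (by positivity)]
  push_cast at h
  linarith

theorem FactorialDecay.hasDerivAt {a : ℕ → ℝ} (ha : FactorialDecay a) (y : ℝ) :
    HasDerivAt (seriesSum a) (seriesSum (fun m => (m + 1) * a (m + 1)) y) y := by
  have hs := (ha.derivCoeff.summable_abs (|y| + 1))
  -- For `m = 0` the truncated exponent `m - 1` is harmless, because the factor `m` kills the term;
  -- the rest is the derived series at `|y| + 1`.
  have hu : Summable fun m : ℕ => |m * a m * (|y| + 1) ^ (m - 1)| := by
    rw [← summable_nat_add_iff 1]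
    simpa using hs
  have key := hasDerivAt_tsum_of_isPreconnected (𝕜 := ℝ) (t := Metric.ball (0 : ℝ) (|y| + 1))
    (g := fun m z => a m * z ^ m) (g' := fun m z => m * a m * z ^ (m - 1)) (y₀ := y) (y := y)
    hu Metric.isOpen_ball (convex_ball _ _).isPreconnected
    (fun n z _ => ((hasDerivAt_pow n z).const_mul (a n)).congr_deriv (by ring))
    (fun n z hz => by
      rw [Real.norm_eq_abs, abs_mul, abs_mul (n * a n), abs_pow, abs_pow]
      rw [mem_ball_zero_iff, Real.norm_eq_abs] at hz
      have := hz.le.trans (le_abs_self (|y| + 1))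
      gcongr)
    (by simp) (ha.summable y) (by simp)
  refine key.congr_deriv ?_
  rw [(show Summable fun m : ℕ => m * a m * y ^ (m - 1) by
    rw [← summable_nat_add_iff 1]; simpa using ha.derivCoeff.summable y).tsum_eq_zero_add]
  simp [seriesSum]

theorem FactorialDecay.continuous {a : ℕ → ℝ} (ha : FactorialDecay a) :
    Continuous (seriesSum a) :=
  continuous_iff_continuousAt.2 fun y => (ha.hasDerivAt y).continuousAt

theorem FactorialDecay.seriesSum_eq_add {a b : ℕ → ℝ} (ha : FactorialDecay a) (y : ℝ)
    (hb : ∀ m, b m = a (m + 1)) : seriesSum a y = a 0 + y * seriesSum b y := by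
  rw [seriesSum, (ha.summable y).tsum_eq_zero_add, seriesSum, ← tsum_mul_left]
  congr 1
  · simp
  · exact tsum_congr fun m => by rw [hb]; ring

theorem FactorialDecay.seriesSum_comb {a b c : ℕ → ℝ} (ha : FactorialDecay a)
    (hb : FactorialDecay b) (s t y : ℝ) (hc : ∀ m, c m = s * a m + t * b m) :
    seriesSum c y = s * seriesSum a y + t * seriesSum b y := by
  simp only [seriesSum]
  rw [← tsum_mul_left, ← tsum_mul_left,
    ← ((ha.summable y).mul_left s).tsum_add ((hb.summable y).mul_left t)]
  exact tsum_congr fun m => by rw [hc]; ring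

theorem FactorialDecay.comb {a b : ℕ → ℝ} (ha : FactorialDecay a)
    (hb : FactorialDecay b) (s t : ℝ) : FactorialDecay fun m => s * a m + t * b m := by
  obtain ⟨C, hC⟩ := ha
  obtain ⟨D, hD⟩ := hb
  refine ⟨|s| * C + |t| * D, fun m => (abs_add_le _ _).trans ?_⟩
  rw [abs_mul, abs_mul, add_div, mul_div_assoc, mul_div_assoc]
  gcongr
  exacts [hC m, hD m]

/-! ### The series of the Bessel functions -/

theorem harmonic_nonneg (m : ℕ) : (0 : ℝ) ≤ (harmonic m : ℝ) := by
  simp only [harmonic]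
  push_cast
  positivity

theorem harmonic_succ_real (m : ℕ) : (harmonic (m + 1) : ℝ) = harmonic m + 1 / (m + 1) := by
  rw [harmonic_succ]; push_cast; ring

theorem harmonic_le_self (m : ℕ) : (harmonic m : ℝ) ≤ m := by
  induction m with
  | zero => simp
  | succ n ih =>
    rw [harmonic_succ_real]
    have : (1 : ℝ) / (n + 1) ≤ 1 := by
      rw [div_le_one (by positivity)]
      linarith [n.cast_nonneg (α := ℝ)]
    push_cast
    linarith

/-- Coefficients of `J_n(x) (x/2)^{-n}` in powers of `x² / 4`. -/
noncomputable def besselJCoeff (n m : ℕ) : ℝ :=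
  (-1) ^ m / ((m.factorial : ℝ) * ((m + n).factorial : ℝ))

/-- Coefficients of the non-logarithmic series of `Y_0`. -/
noncomputable def besselYCoeffZero (m : ℕ) : ℝ :=
  (-1) ^ m * harmonic m / ((m.factorial : ℝ) * (m.factorial : ℝ))

/-- Coefficients of the non-logarithmic series of `Y_1`. -/
noncomputable def besselYCoeffOne (m : ℕ) : ℝ :=
  (-1) ^ m * (harmonic m + harmonic (m + 1)) / ((m.factorial : ℝ) * ((m + 1).factorial : ℝ))

theorem one_le_factorial_real (m : ℕ) : (1 : ℝ) ≤ m.factorial := by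
  exact_mod_cast Nat.one_le_iff_ne_zero.2 m.factorial_ne_zero

theorem self_le_factorial_real (m : ℕ) : (m : ℝ) ≤ m.factorial := by
  exact_mod_cast Nat.self_le_factorial m

theorem besselJCoeff_decay (n : ℕ) : FactorialDecay (besselJCoeff n) := by
  refine ⟨1, fun m => ?_⟩
  rw [besselJCoeff, abs_div, abs_pow, abs_neg, abs_one, one_pow, abs_of_pos (by positivity)]
  gcongr
  exact le_mul_of_one_le_right (by positivity) (one_le_factorial_real _)

theorem besselYCoeffZero_decay : FactorialDecay besselYCoeffZero := by
  refine ⟨1, fun m => ?_⟩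
  rw [besselYCoeffZero, abs_div, abs_mul, abs_pow, abs_neg, abs_one, one_pow, one_mul,
    abs_of_nonneg (harmonic_nonneg m), abs_of_pos (by positivity), div_le_div_iff₀ (by positivity)
      (by positivity), one_mul, mul_comm]
  gcongr
  exact (harmonic_le_self m).trans (self_le_factorial_real m)

theorem besselYCoeffOne_decay : FactorialDecay besselYCoeffOne := by
  refine ⟨2, fun m => ?_⟩
  rw [besselYCoeffOne, abs_div, abs_mul, abs_pow, abs_neg, abs_one, one_pow, one_mul,
    abs_of_nonneg (add_nonneg (harmonic_nonneg m) (harmonic_nonneg _)), abs_of_pos (by positivity),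
    div_le_div_iff₀ (by positivity) (by positivity), mul_comm, mul_left_comm]
  gcongr
  have h1 := (harmonic_le_self m)
  have h2 := (harmonic_le_self (m + 1)).trans (self_le_factorial_real _)
  have h3 := self_le_factorial_real (m + 1)
  push_cast at h3
  linarith

theorem besselJ_zero_eq (x : ℝ) : besselJ 0 x = seriesSum (besselJCoeff 0) (x ^ 2 / 4) := by
  refine tsum_congr fun m => ?_
  simp only [besselJCoeff, add_zero, pow_mul, div_pow]; norm_num

theorem besselJ_one_eq (x : ℝ) :
    besselJ 1 x = x / 2 * seriesSum (besselJCoeff 1) (x ^ 2 / 4) := by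
  rw [besselJ, seriesSum, ← tsum_mul_left]
  refine tsum_congr fun m => ?_
  rw [besselJCoeff, pow_succ, pow_mul]; ring

theorem besselY_zero_eq (x : ℝ) : besselY 0 x =
    2 / Real.pi * ((Real.log (x / 2) + Real.eulerMascheroniConstant) * besselJ 0 x
      - seriesSum besselYCoeffZero (x ^ 2 / 4)) := by
  have h := besselYCoeffZero_decay.seriesSum_comb (besselJCoeff_decay 0) 2
    (-2 * Real.eulerMascheroniConstant) (x ^ 2 / 4) (c := fun m => (-1) ^ m *
      (digammaSucc m + digammaSucc (m + 0)) / ((m.factorial : ℝ) * ((m + 0).factorial : ℝ)))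
    (fun m => by
      simp only [digammaSucc, besselYCoeffZero, besselJCoeff, add_zero]; ring)
  have h2 : ∑' m : ℕ, (-1 : ℝ) ^ m * (digammaSucc m + digammaSucc (m + 0)) /
          ((m.factorial : ℝ) * ((m + 0).factorial : ℝ)) * (x / 2) ^ (2 * m + 0) =
      seriesSum (fun m => (-1) ^ m *
      (digammaSucc m + digammaSucc (m + 0)) / ((m.factorial : ℝ) * ((m + 0).factorial : ℝ)))
        (x ^ 2 / 4) := by
    refine tsum_congr fun m => ?_
    simp only [add_zero, pow_mul, div_pow]; norm_num
  rw [besselY, h2, h, ← besselJ_zero_eq]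
  simp only [Finset.range_zero, Finset.sum_empty]
  ring

theorem besselY_one_eq (x : ℝ) : besselY 1 x =
    2 / Real.pi * (Real.log (x / 2) + Real.eulerMascheroniConstant) * besselJ 1 x
      - 2 / (Real.pi * x) - x / (2 * Real.pi) * seriesSum besselYCoeffOne (x ^ 2 / 4) := by
  have h := besselYCoeffOne_decay.seriesSum_comb (besselJCoeff_decay 1) 1
    (-2 * Real.eulerMascheroniConstant) (x ^ 2 / 4) (c := fun m => (-1) ^ m *
      (digammaSucc m + digammaSucc (m + 1)) / ((m.factorial : ℝ) * ((m + 1).factorial : ℝ)))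
    (fun m => by
      simp only [digammaSucc, besselYCoeffOne, besselJCoeff]; ring)
  have h2 : ∑' m : ℕ, (-1 : ℝ) ^ m * (digammaSucc m + digammaSucc (m + 1)) /
          ((m.factorial : ℝ) * ((m + 1).factorial : ℝ)) * (x / 2) ^ (2 * m + 1) =
      x / 2 * seriesSum (fun m => (-1) ^ m *
      (digammaSucc m + digammaSucc (m + 1)) / ((m.factorial : ℝ) * ((m + 1).factorial : ℝ)))
        (x ^ 2 / 4) := by
    rw [seriesSum, ← tsum_mul_left]
    refine tsum_congr fun m => ?_
    rw [pow_succ, pow_mul, div_pow x 2 2]; norm_num; ring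
  rw [besselY, h2, h, besselJ_one_eq]
  simp only [Finset.range_one, Finset.sum_singleton]
  have hx : 2 / (Real.pi * x) = 1 / Real.pi * (1 / (x / 2)) := by
    rw [one_div_div, div_mul_div_comm, one_mul]
  rw [hx]
  simp
  ring

theorem seriesSum_besselJCoeff_deriv (y : ℝ) :
    HasDerivAt (seriesSum (besselJCoeff 0)) (-seriesSum (besselJCoeff 1) y) y := by
  refine ((besselJCoeff_decay 0).hasDerivAt y).congr_deriv ?_
  rw [seriesSum, seriesSum, ← tsum_neg]
  refine tsum_congr fun m => ?_
  simp only [besselJCoeff, add_zero, Nat.factorial_succ]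
  push_cast
  field_simp
  ring

theorem besselJ_zero_hasDerivAt (x : ℝ) : HasDerivAt (besselJ 0) (-besselJ 1 x) x := by
  have h : HasDerivAt (fun x : ℝ => x ^ 2 / 4) (x / 2) x :=
    ((hasDerivAt_pow 2 x).div_const 4).congr_deriv (by ring)
  have := (seriesSum_besselJCoeff_deriv (x ^ 2 / 4)).comp x h
  rw [show besselJ 0 = seriesSum (besselJCoeff 0) ∘ fun x => x ^ 2 / 4 from
    funext besselJ_zero_eq]
  exact this.congr_deriv (by rw [besselJ_one_eq]; ring)

/-- Multiplication by `y` shifts coefficients, so this is termwise differentiation of the shifted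
series. It serves the derivatives of `x J₁` and `x Y₁`. -/
theorem mul_seriesSum_hasDerivAt {a c : ℕ → ℝ} (hc : FactorialDecay c)
    (hac : ∀ m, c m = (m + 1) * a m) (y : ℝ) :
    HasDerivAt (fun y => y * seriesSum a y) (seriesSum c y) y := by
  -- The coefficients of `y · seriesSum a y`: a zero is put in front of `a`.
  let b : ℕ → ℝ := fun m => Nat.casesOn m 0 a
  have hb : FactorialDecay b := by
    obtain ⟨C, hC⟩ := hc
    refine ⟨C, fun m => ?_⟩
    cases m with
    | zero =>
      have := (abs_nonneg _).trans (hC 0)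
      simpa [b] using this
    | succ n =>
      have h := hC n
      rw [hac, abs_mul, abs_of_pos (by positivity), le_div_iff₀ (by positivity)] at h
      rw [le_div_iff₀ (by positivity), Nat.factorial_succ]
      push_cast
      change |a n| * _ ≤ C
      linarith
  have h := hb.hasDerivAt y
  rw [show seriesSum b = fun y => y * seriesSum a y from funext fun z => by
    rw [hb.seriesSum_eq_add (b := a) z (fun m => rfl)]; simp [b]] at h
  refine h.congr_deriv (congrArg (fun c => seriesSum c y) (funext fun m => ?_))
  rw [hac]

theorem hasDerivAt_sq_div_four (x : ℝ) : HasDerivAt (fun x : ℝ => x ^ 2 / 4) (x / 2) x :=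
  ((hasDerivAt_pow 2 x).div_const 4).congr_deriv (by ring)

theorem mul_besselJ_one_hasDerivAt (x : ℝ) :
    HasDerivAt (fun x => x * besselJ 1 x) (x * besselJ 0 x) x := by
  have h := (mul_seriesSum_hasDerivAt (a := besselJCoeff 1) (besselJCoeff_decay 0)
    (fun m => by
      simp only [besselJCoeff, add_zero, Nat.factorial_succ]
      push_cast
      field_simp) (x ^ 2 / 4)).comp x (hasDerivAt_sq_div_four x)
  rw [show (fun x => x * besselJ 1 x) = fun x => 2 * (x ^ 2 / 4 *
    seriesSum (besselJCoeff 1) (x ^ 2 / 4)) from funext fun x => by rw [besselJ_one_eq]; ring]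
  exact (h.const_mul 2).congr_deriv (by rw [besselJ_zero_eq]; ring)

/-- Coefficientwise this is `2 H_{m+1} - H_m - H_{m+1} = 1/(m+1)` for harmonic numbers. It is what
makes the non-logarithmic parts match in `Y₀' = -Y₁`. -/
theorem seriesSum_besselJCoeff_zero_eq (y : ℝ) : seriesSum (besselJCoeff 0) y =
    1 + y * (2 * seriesSum (fun m => (m + 1) * besselYCoeffZero (m + 1)) y
      + seriesSum besselYCoeffOne y) := by
  rw [(besselJCoeff_decay 0).seriesSum_eq_add y (fun m => rfl),
    besselYCoeffZero_decay.derivCoeff.seriesSum_comb besselYCoeffOne_decay 2 1 y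
    (c := fun m => besselJCoeff 0 (m + 1))]
  · simp [besselJCoeff]
  · intro m
    simp only [besselJCoeff, besselYCoeffZero, besselYCoeffOne, harmonic_succ_real, add_zero,
      Nat.factorial_succ]
    push_cast
    field_simp
    ring

theorem log_half_hasDerivAt {x : ℝ} (hx : 0 < x) :
    HasDerivAt (fun x : ℝ => Real.log (x / 2) + Real.eulerMascheroniConstant) (1 / x) x := by
  have := ((hasDerivAt_id x).div_const 2).log (by simp [hx.ne'])
  refine (this.add_const _).congr_deriv ?_
  simp only [id]; field_simp

theorem besselY_zero_hasDerivAt {x : ℝ} (hx : 0 < x) :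
    HasDerivAt (besselY 0) (-besselY 1 x) x := by
  have h := (besselYCoeffZero_decay.hasDerivAt (x ^ 2 / 4)).comp x (hasDerivAt_sq_div_four x)
  have h2 := (((log_half_hasDerivAt hx).mul (besselJ_zero_hasDerivAt x)).sub h).const_mul
    (2 / Real.pi)
  rw [show besselY 0 = _ from funext besselY_zero_eq]
  refine h2.congr_deriv ?_
  have h3 := seriesSum_besselJCoeff_zero_eq (x ^ 2 / 4)
  rw [← besselJ_zero_eq] at h3
  rw [besselY_one_eq, h3]
  field_simp
  ring

/-- Differentiating the logarithm leaves an extra `J₁`; it cancels against the `besselJCoeff 1` part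
of the derived series, which comes from `H_m + H_{m+1} = 2 H_m + 1/(m+1)`. -/
theorem mul_besselY_one_hasDerivAt {x : ℝ} (hx : 0 < x) :
    HasDerivAt (fun x => x * besselY 1 x) (x * besselY 0 x) x := by
  have hc := besselYCoeffZero_decay.comb (besselJCoeff_decay 1) 2 1
  have h := (mul_seriesSum_hasDerivAt (a := besselYCoeffOne) hc
    (fun m => by
      simp only [besselJCoeff, besselYCoeffZero, besselYCoeffOne, harmonic_succ_real,
        Nat.factorial_succ]
      push_cast
      field_simp
      ring) (x ^ 2 / 4)).comp x (hasDerivAt_sq_div_four x)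
  rw [besselYCoeffZero_decay.seriesSum_comb (besselJCoeff_decay 1) 2 1 (x ^ 2 / 4)
    (fun m => rfl)] at h
  have h2 := ((((log_half_hasDerivAt hx).mul (mul_besselJ_one_hasDerivAt x)).sub h).sub_const
    1).const_mul (2 / Real.pi)
  refine (h2.congr_deriv ?_).congr_of_eventuallyEq ?_
  · rw [besselY_zero_eq, besselJ_one_eq]
    field_simp
    ring
  · filter_upwards [lt_mem_nhds hx] with z hz
    rw [besselY_one_eq]
    simp only [Pi.sub_apply, Pi.mul_apply, Function.comp]
    field_simp
    ring

/-! ### The Hankel functions: differential relations and behaviour at the origin -/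

theorem hankel1_zero_hasDerivAt {x : ℝ} (hx : 0 < x) :
    HasDerivAt (hankel1 0) (-hankel1 1 x) x :=
  ((besselJ_zero_hasDerivAt x).ofReal_comp.add
    ((besselY_zero_hasDerivAt hx).ofReal_comp.const_mul Complex.I)).congr_deriv (by
      simp only [hankel1]; push_cast; ring)

theorem mul_hankel1_one_hasDerivAt {x : ℝ} (hx : 0 < x) :
    HasDerivAt (fun x : ℝ => (x : ℂ) * hankel1 1 x) (x * hankel1 0 x) x := by
  have := (mul_besselJ_one_hasDerivAt x).ofReal_comp.add
    ((mul_besselY_one_hasDerivAt hx).ofReal_comp.const_mul Complex.I)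
  refine (this.congr_deriv (by simp only [hankel1]; push_cast; ring)).congr_of_eventuallyEq
    (.of_forall fun z => ?_)
  simp only [hankel1, Pi.add_apply]; push_cast; ring

theorem tendsto_seriesSum_sq {a : ℕ → ℝ} (ha : FactorialDecay a) :
    Tendsto (fun x : ℝ => seriesSum a (x ^ 2 / 4)) (𝓝[>] 0) (𝓝 (a 0)) := by
  have h : Continuous fun x : ℝ => seriesSum a (x ^ 2 / 4) :=
    ha.continuous.comp (by fun_prop)
  have h2 := (h.tendsto 0).mono_left (nhdsWithin_le_nhds (s := Set.Ioi 0))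
  convert h2 using 2
  rw [seriesSum, tsum_eq_single 0]
  · simp
  · intro m hm; simp [hm]

theorem besselJ_zero_sub_one_eq (x : ℝ) : besselJ 0 x - 1 =
    x ^ 2 / 4 * seriesSum (fun m => besselJCoeff 0 (m + 1)) (x ^ 2 / 4) := by
  rw [besselJ_zero_eq, (besselJCoeff_decay 0).seriesSum_eq_add _ (fun m => rfl)]
  simp [besselJCoeff]

theorem FactorialDecay.shift {a : ℕ → ℝ} (ha : FactorialDecay a) :
    FactorialDecay fun m => a (m + 1) := by
  obtain ⟨C, hC⟩ := ha
  have hC0 : 0 ≤ C := by simpa using (abs_nonneg _).trans (hC 0)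
  refine ⟨C, fun m => (hC (m + 1)).trans ?_⟩
  gcongr
  omega

theorem tendsto_self_mul_log_half :
    Tendsto (fun x : ℝ => x * (Real.log (x / 2) + Real.eulerMascheroniConstant))
      (𝓝[>] 0) (𝓝 0) := by
  have h1 : Tendsto (fun x : ℝ => x * Real.log x + x *
      (Real.eulerMascheroniConstant - Real.log 2)) (𝓝[>] 0) (𝓝 0) := by
    have : Continuous fun x : ℝ => x * Real.log x + x *
      (Real.eulerMascheroniConstant - Real.log 2) := by
      have := Real.continuous_mul_log
      fun_prop
    convert (this.tendsto 0).mono_left (nhdsWithin_le_nhds (s := Set.Ioi 0)) using 2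
    simp
  refine h1.congr' ?_
  filter_upwards [self_mem_nhdsWithin] with x hx
  rw [Real.log_div (ne_of_gt hx) two_ne_zero]
  ring

theorem tendsto_id_nhdsGT_zero : Tendsto (fun x : ℝ => x) (𝓝[>] 0) (𝓝 0) :=
  tendsto_id.mono_left nhdsWithin_le_nhds

theorem tendsto_hankel1_zero :
    Tendsto (fun x : ℝ => hankel1 0 x -
      (1 + Complex.I * ((2 / Real.pi * (Real.log (x / 2) + Real.eulerMascheroniConstant) : ℝ) : ℂ)))
      (𝓝[>] 0) (𝓝 0) := by
  have hJ : Tendsto (fun x : ℝ => besselJ 0 x - 1) (𝓝[>] 0) (𝓝 0) := by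
    have := (tendsto_seriesSum_sq (besselJCoeff_decay 0)).sub_const 1
    simpa [besselJCoeff, ← besselJ_zero_eq] using this
  have hY : Tendsto (fun x : ℝ => besselY 0 x -
      2 / Real.pi * (Real.log (x / 2) + Real.eulerMascheroniConstant)) (𝓝[>] 0) (𝓝 0) := by
    have h1 := ((((tendsto_self_mul_log_half.mul tendsto_id_nhdsGT_zero).mul
      (tendsto_seriesSum_sq (besselJCoeff_decay 0).shift)).const_mul (1 / 4)).sub
      (tendsto_seriesSum_sq besselYCoeffZero_decay)).const_mul (2 / Real.pi)
    have h0 : besselYCoeffZero 0 = 0 := by simp [besselYCoeffZero]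
    rw [h0] at h1
    simp only [mul_zero, zero_mul, sub_zero] at h1
    refine h1.congr fun x => ?_
    have h := besselJ_zero_sub_one_eq x
    rw [besselY_zero_eq, show besselJ 0 x = 1 + (besselJ 0 x - 1) by ring, h]
    ring
  have h1 := (Complex.continuous_ofReal.tendsto 0).comp hJ
  have h2 := ((Complex.continuous_ofReal.tendsto 0).comp hY).const_mul Complex.I
  have h3 := h1.add h2
  simp only [Complex.ofReal_zero, mul_zero, add_zero] at h3
  refine h3.congr fun x => ?_
  simp only [Function.comp, hankel1]
  push_cast
  ring

theorem tendsto_mul_hankel1_one :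
    Tendsto (fun x : ℝ => (x : ℂ) * hankel1 1 x) (𝓝[>] 0) (𝓝 (-(2 * Complex.I / Real.pi))) := by
  have hf := tendsto_seriesSum_sq (besselJCoeff_decay 1)
  have hJ : Tendsto (fun x : ℝ => x * besselJ 1 x) (𝓝[>] 0) (𝓝 0) := by
    have := ((tendsto_id_nhdsGT_zero.mul tendsto_id_nhdsGT_zero).mul hf).const_mul (1 / 2)
    simp only [mul_zero, zero_mul] at this
    exact this.congr fun x => by rw [besselJ_one_eq]; ring
  have hY : Tendsto (fun x : ℝ => x * besselY 1 x) (𝓝[>] 0) (𝓝 (-(2 / Real.pi))) := by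
    have h1 := ((((tendsto_self_mul_log_half.mul tendsto_id_nhdsGT_zero).mul hf).const_mul
      (1 / Real.pi)).sub (((tendsto_id_nhdsGT_zero.mul tendsto_id_nhdsGT_zero).mul
      (tendsto_seriesSum_sq besselYCoeffOne_decay)).const_mul (1 / (2 * Real.pi)))).sub_const
      (2 / Real.pi)
    simp only [mul_zero, zero_mul, sub_zero, zero_sub] at h1
    refine h1.congr' ?_
    filter_upwards [self_mem_nhdsWithin] with x hx
    have : x ≠ 0 := ne_of_gt hx
    rw [besselY_one_eq, besselJ_one_eq]
    field_simp
    ring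
  have h1 := (Complex.continuous_ofReal.tendsto _).comp hJ
  have h2 := ((Complex.continuous_ofReal.tendsto _).comp hY).const_mul Complex.I
  have h3 := h1.add h2
  convert h3 using 2
  · simp only [Function.comp, hankel1]
    push_cast
    ring
  · push_cast; ring

/-! ### The square root `√(t² - 2ix)` -/

/-- `√(t² - 2ix)`. -/
noncomputable def laplaceRoot (x t : ℝ) : ℂ := ((t : ℂ) ^ 2 - 2 * Complex.I * x) ^ (1 / 2 : ℂ)

/-- Fixes the branch: identities between square roots are checked after squaring. -/
theorem eq_of_sq_eq_of_re_pos {a b : ℂ} (ha : 0 < a.re) (hb : 0 < b.re) (h : a ^ 2 = b ^ 2) :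
    a = b := by
  rcases sq_eq_sq_iff_eq_or_eq_neg.1 h with h | h
  · exact h
  · rw [h, Complex.neg_re] at ha
    linarith

theorem radicand_re (x t : ℝ) : ((t : ℂ) ^ 2 - 2 * Complex.I * x).re = t ^ 2 := by
  simp [sq]

theorem radicand_im (x t : ℝ) : ((t : ℂ) ^ 2 - 2 * Complex.I * x).im = -2 * x := by
  simp [sq]

theorem radicand_mem_slitPlane {x t : ℝ} (h : x ≠ 0 ∨ t ≠ 0) :
    (t : ℂ) ^ 2 - 2 * Complex.I * x ∈ Complex.slitPlane := by
  rw [Complex.mem_slitPlane_iff, radicand_re, radicand_im]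
  rcases h with h | h
  · right; simpa using h
  · left; positivity

theorem laplaceRoot_sq (x t : ℝ) : laplaceRoot x t ^ 2 = (t : ℂ) ^ 2 - 2 * Complex.I * x := by
  rw [laplaceRoot, ← Complex.cpow_nat_mul]
  norm_num

theorem laplaceRoot_re_pos {x t : ℝ} (h : x ≠ 0 ∨ t ≠ 0) : 0 < (laplaceRoot x t).re := by
  have hs := radicand_mem_slitPlane h
  have h0 := Complex.slitPlane_ne_zero hs
  rw [laplaceRoot, Complex.cpow_def_of_ne_zero h0, Complex.exp_re]
  have him : (Complex.log ((t : ℂ) ^ 2 - 2 * Complex.I * x) * (1 / 2)).im =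
      ((t : ℂ) ^ 2 - 2 * Complex.I * x).arg / 2 := by
    rw [show (1 / 2 : ℂ) = ((1 / 2 : ℝ) : ℂ) by push_cast; rfl, Complex.im_mul_ofReal,
      Complex.log_im]
    ring
  rw [him]
  have h1 := Complex.neg_pi_lt_arg ((t : ℂ) ^ 2 - 2 * Complex.I * x)
  have h2 := (Complex.arg_le_pi ((t : ℂ) ^ 2 - 2 * Complex.I * x)).lt_of_ne
    (Complex.mem_slitPlane_iff_arg.1 hs).1
  have := Real.cos_pos_of_mem_Ioo (x := ((t : ℂ) ^ 2 - 2 * Complex.I * x).arg / 2)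
    ⟨by linarith, by linarith⟩
  positivity

theorem laplaceRoot_ne_zero {x t : ℝ} (h : x ≠ 0 ∨ t ≠ 0) : laplaceRoot x t ≠ 0 := fun h0 => by
  have := laplaceRoot_re_pos h
  rw [h0] at this
  exact lt_irrefl _ this

theorem norm_laplaceRoot_sq (x t : ℝ) :
    ‖laplaceRoot x t‖ ^ 2 = ‖(t : ℂ) ^ 2 - 2 * Complex.I * x‖ := by
  rw [← norm_pow, laplaceRoot_sq]

/-- From the real part `t²` of the radicand. Being uniform in `x`, it supplies the domination as `x
→ 0`. -/
theorem self_le_norm_laplaceRoot (x t : ℝ) : t ≤ ‖laplaceRoot x t‖ := by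
  refine (abs_le_of_sq_le_sq' ?_ (norm_nonneg _)).2
  rw [norm_laplaceRoot_sq, ← radicand_re x t]
  exact Complex.re_le_norm _

/-- From the imaginary part `-2x` of the radicand. At `x = 1` it gives the constant `√2` behind the
sharp modulus bounds. -/
theorem sqrt_le_norm_laplaceRoot (x t : ℝ) : √(2 * x) ≤ ‖laplaceRoot x t‖ := by
  refine Real.sqrt_le_iff.2 ⟨norm_nonneg _, ?_⟩
  rw [norm_laplaceRoot_sq]
  have := Complex.abs_im_le_norm ((t : ℂ) ^ 2 - 2 * Complex.I * x)
  rw [radicand_im, abs_le] at this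
  linarith [this.1]

theorem norm_laplaceRoot_le {x t : ℝ} (hx : 0 ≤ x) (hx1 : x ≤ 1) (ht : 0 ≤ t) :
    ‖laplaceRoot x t‖ ≤ t + 2 := by
  refine (abs_le_of_sq_le_sq' ?_ (by positivity)).2
  rw [norm_laplaceRoot_sq]
  refine (norm_sub_le _ _).trans ?_
  simp only [norm_pow, norm_mul, Complex.norm_real, Complex.norm_I, Complex.norm_ofNat,
    Real.norm_eq_abs, abs_of_nonneg hx, abs_of_nonneg ht]
  nlinarith

theorem laplaceRoot_hasDerivAt {x t : ℝ} (h : x ≠ 0 ∨ t ≠ 0) :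
    HasDerivAt (laplaceRoot x) (t / laplaceRoot x t) t := by
  have h1 : HasDerivAt (fun t : ℝ => (t : ℂ) ^ 2 - 2 * Complex.I * x)
      ((2 * t : ℝ) : ℂ) t := by
    have h := (((hasDerivAt_pow 2 t).ofReal_comp).sub_const (2 * Complex.I * x))
    simpa using h
  have hs := radicand_mem_slitPlane h
  have h2 := (Complex.hasStrictDerivAt_cpow_const (c := 1 / 2) hs).hasDerivAt.comp_of_eq t h1 rfl
  refine h2.congr_deriv ?_
  rw [show (1 / 2 - 1 : ℂ) = -(1 / 2) by norm_num, Complex.cpow_neg, ← laplaceRoot]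
  push_cast
  field_simp

theorem laplaceRoot_zero_left {t : ℝ} (ht : 0 < t) : laplaceRoot 0 t = t := by
  refine eq_of_sq_eq_of_re_pos (laplaceRoot_re_pos (.inr ht.ne')) (by simpa using ht) ?_
  rw [laplaceRoot_sq]
  simp

theorem laplaceRoot_scale {x t : ℝ} (hx : 0 < x) (ht : 0 < t) :
    laplaceRoot x (√x * t) = √x * laplaceRoot 1 t := by
  have hs : 0 < √x := Real.sqrt_pos.2 hx
  refine eq_of_sq_eq_of_re_pos (laplaceRoot_re_pos (.inl hx.ne')) ?_ ?_
  · rw [Complex.re_ofReal_mul]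
    exact mul_pos hs (laplaceRoot_re_pos (.inr ht.ne'))
  · rw [mul_pow, laplaceRoot_sq, laplaceRoot_sq, Complex.ofReal_mul, mul_pow, ← Complex.ofReal_pow,
      Real.sq_sqrt hx.le]
    push_cast
    ring

theorem continuous_laplaceRoot {x : ℝ} (hx : x ≠ 0) : Continuous (laplaceRoot x) :=
  continuous_iff_continuousAt.2 fun _ => (laplaceRoot_hasDerivAt (.inl hx)).continuousAt

theorem continuousAt_laplaceRoot_left {t : ℝ} (ht : t ≠ 0) :
    ContinuousAt (fun x => laplaceRoot x t) 0 := by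
  have h1 : Continuous fun x : ℝ => (t : ℂ) ^ 2 - 2 * Complex.I * x := by fun_prop
  exact h1.continuousAt.cpow continuousAt_const (radicand_mem_slitPlane (.inr ht))

/-! ### The Laplace integrals -/

/-- The integral `∫₀^∞ wᵏ e^{-xw²} (w² - 2i)^{-1/2} dw`. -/
noncomputable def laplaceInt (k : ℕ) (x : ℝ) : ℂ :=
  ∫ w in Set.Ioi (0 : ℝ), ((w ^ k * Real.exp (-x * w ^ 2) : ℝ) : ℂ) * (laplaceRoot 1 w)⁻¹

theorem integrableOn_pow_mul_gaussian (k : ℕ) {x : ℝ} (hx : 0 < x) :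
    IntegrableOn (fun w : ℝ => w ^ k * Real.exp (-x * w ^ 2)) (Set.Ioi 0) := by
  have := integrableOn_rpow_mul_exp_neg_mul_sq hx (s := k) (by
    have := k.cast_nonneg (α := ℝ); linarith)
  simpa only [Real.rpow_natCast] using this

theorem norm_laplaceIntegrand_le (k : ℕ) (x : ℝ) {w : ℝ} (hw : 0 < w) :
    ‖((w ^ k * Real.exp (-x * w ^ 2) : ℝ) : ℂ) * (laplaceRoot 1 w)⁻¹‖ ≤
      w ^ k * Real.exp (-x * w ^ 2) * (√2)⁻¹ := by
  rw [norm_mul, Complex.norm_real, Real.norm_of_nonneg (by positivity), norm_inv]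
  have := sqrt_le_norm_laplaceRoot 1 w
  rw [mul_one] at this
  gcongr

theorem integrableOn_laplaceIntegrand (k : ℕ) {x : ℝ} (hx : 0 < x) :
    IntegrableOn (fun w : ℝ => ((w ^ k * Real.exp (-x * w ^ 2) : ℝ) : ℂ) * (laplaceRoot 1 w)⁻¹)
      (Set.Ioi 0) := by
  refine ((integrableOn_pow_mul_gaussian k hx).mul_const (√2)⁻¹).mono' ?_ ?_
  · have := continuous_laplaceRoot one_ne_zero
    refine Continuous.aestronglyMeasurable (.mul (by fun_prop) (this.inv₀ fun t =>
      laplaceRoot_ne_zero (.inl one_ne_zero)))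
  · exact (ae_restrict_iff' measurableSet_Ioi).2 (.of_forall fun w hw =>
      norm_laplaceIntegrand_le k x hw)

theorem norm_laplaceInt_le (k : ℕ) {x : ℝ} (hx : 0 < x) : ‖laplaceInt k x‖ ≤
    (∫ w in Set.Ioi (0 : ℝ), w ^ k * Real.exp (-x * w ^ 2)) * (√2)⁻¹ := by
  rw [← integral_mul_const]
  exact norm_integral_le_of_norm_le ((integrableOn_pow_mul_gaussian k hx).mul_const _)
    ((ae_restrict_iff' measurableSet_Ioi).2 (.of_forall fun w hw =>
      norm_laplaceIntegrand_le k x hw))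

theorem laplaceInt_hasDerivAt (k : ℕ) {x : ℝ} (hx : 0 < x) :
    HasDerivAt (laplaceInt k) (-laplaceInt (k + 2) x) x := by
  have h := (hasDerivAt_integral_of_dominated_loc_of_deriv_le
    (μ := volume.restrict (Set.Ioi (0 : ℝ)))
    (bound := fun w => w ^ (k + 2) * Real.exp (-(x / 2) * w ^ 2) * (√2)⁻¹)
    (F := fun x w => ((w ^ k * Real.exp (-x * w ^ 2) : ℝ) : ℂ) * (laplaceRoot 1 w)⁻¹)
    (F' := fun x w => -(((w ^ (k + 2) * Real.exp (-x * w ^ 2) : ℝ) : ℂ) * (laplaceRoot 1 w)⁻¹))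
    (Ioi_mem_nhds (half_lt_self hx)) ?_ (integrableOn_laplaceIntegrand k hx)
    (integrableOn_laplaceIntegrand (k + 2) hx).neg.aestronglyMeasurable ?_
    ((integrableOn_pow_mul_gaussian _ (half_pos hx)).mul_const _) ?_).2
  · rwa [integral_neg] at h
  · filter_upwards [lt_mem_nhds hx] with y hy
    exact (integrableOn_laplaceIntegrand k hy).aestronglyMeasurable
  · refine (ae_restrict_iff' measurableSet_Ioi).2 (.of_forall fun w hw y hy => ?_)
    have hw : 0 < w := hw
    have hy : x / 2 < y := hy
    rw [norm_neg]
    refine (norm_laplaceIntegrand_le (k + 2) y hw).trans ?_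
    gcongr
  · refine .of_forall fun w y _ => ?_
    have h1 : HasDerivAt (fun y => w ^ k * Real.exp (-y * w ^ 2))
        (-(w ^ (k + 2) * Real.exp (-y * w ^ 2))) y := by
      refine ((((hasDerivAt_id y).neg.mul_const (w ^ 2)).exp).const_mul (w ^ k)).congr_deriv ?_
      simp; ring
    refine (h1.ofReal_comp.mul_const _).congr_deriv ?_
    push_cast
    ring

/-- Integration of the derivative of `w e^{-xw²} √(w² - 2i)`, which vanishes at both ends. It
encodes the Bessel equation and is used for `(x H₁)' = x H₀` on the Laplace side. -/
theorem laplaceInt_recurrence {x : ℝ} (hx : 0 < x) :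
    laplaceInt 2 x - Complex.I * laplaceInt 0 x +
      x * (2 * Complex.I * laplaceInt 2 x - laplaceInt 4 x) = 0 := by
  let f : ℝ → ℂ := fun w =>
    ((w ^ 1 * Real.exp (-x * w ^ 2) : ℝ) : ℂ) * laplaceRoot 1 w
  let e : ℕ → ℝ → ℂ := fun k w =>
    ((w ^ k * Real.exp (-x * w ^ 2) : ℝ) : ℂ) * (laplaceRoot 1 w)⁻¹
  let f' : ℝ → ℂ := fun w => 2 * (e 2 w - Complex.I * e 0 w
      + (2 * Complex.I * x) * e 2 w - x * e 4 w)
  have hroot : ∀ w : ℝ, laplaceRoot 1 w ≠ 0 := fun w => laplaceRoot_ne_zero (.inl one_ne_zero)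
  have he : ∀ k, IntegrableOn (e k) (Set.Ioi 0) := fun k => integrableOn_laplaceIntegrand k hx
  have hf : ∀ w, HasDerivAt f (f' w) w := fun w => by
    have h1 : HasDerivAt (fun w => w ^ 1 * Real.exp (-x * w ^ 2))
        ((1 - 2 * x * w ^ 2) * Real.exp (-x * w ^ 2)) w := by
      refine ((hasDerivAt_pow 1 w).mul (((hasDerivAt_pow 2 w).const_mul (-x)).exp)).congr_deriv ?_
      simp; ring
    refine (h1.ofReal_comp.mul (laplaceRoot_hasDerivAt (x := 1) (.inl one_ne_zero))).congr_deriv ?_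
    have hr := laplaceRoot_sq 1 w
    have := hroot w
    simp only [f', e]
    push_cast at hr ⊢
    field_simp
    rw [hr]
    ring
  have hint : IntegrableOn f' (Set.Ioi 0) :=
    (((((he 2).sub ((he 0).const_mul _)).add ((he 2).const_mul _)).sub
      ((he 4).const_mul _)).const_mul 2)
  have hfint : IntegrableOn f (Set.Ioi 0) := by
    refine ((he 3).sub ((he 1).const_mul (2 * Complex.I))).congr_fun (fun w _ => ?_)
      measurableSet_Ioi
    have hr := laplaceRoot_sq 1 w
    have := hroot w
    simp only [f, e, Pi.sub_apply]
    push_cast at hr ⊢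
    field_simp
    rw [hr]
    ring
  have hlim := tendsto_zero_of_hasDerivAt_of_integrableOn_Ioi (fun w _ => hf w) hint hfint
  have key := integral_Ioi_of_hasDerivAt_of_tendsto (hf 0).continuousAt.continuousWithinAt
    (fun w _ => hf w) hint hlim
  have h2 : ∫ w in Set.Ioi (0 : ℝ), f' w = 2 * (laplaceInt 2 x - Complex.I * laplaceInt 0 x
      + (2 * Complex.I * x) * laplaceInt 2 x - x * laplaceInt 4 x) := by
    simp only [f']
    rw [integral_const_mul, integral_sub _ ((he 4).const_mul _),
      integral_add _ ((he 2).const_mul _), integral_sub (he 2) ((he 0).const_mul _)]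
    · simp only [integral_const_mul]; rfl
    · exact (he 2).sub ((he 0).const_mul _)
    · exact ((he 2).sub ((he 0).const_mul _)).add ((he 2).const_mul _)
  rw [h2] at key
  have h0 : f 0 = 0 := by simp [f]
  rw [h0] at key
  linear_combination key / 2

/-! ### Behaviour of the Laplace integrals at the origin -/

/-- The substitution `t = √x w` moves `x` from the Gaussian into the root, where the limit `x → 0`
can be taken. -/
theorem laplaceInt_scale (k : ℕ) {x : ℝ} (hx : 0 < x) : (√x : ℂ) ^ k * laplaceInt k x =
    ∫ t in Set.Ioi (0 : ℝ), ((t ^ k * Real.exp (-t ^ 2) : ℝ) : ℂ) * (laplaceRoot x t)⁻¹ := by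
  have hs : 0 < √x := Real.sqrt_pos.2 hx
  have hs' : (√x : ℂ) ≠ 0 := by exact_mod_cast hs.ne'
  have h := integral_comp_mul_left_Ioi
    (fun t : ℝ => ((t ^ k * Real.exp (-t ^ 2) : ℝ) : ℂ) * (laplaceRoot x t)⁻¹) 0 hs
  rw [mul_zero] at h
  have h2 : ∫ w in Set.Ioi (0 : ℝ), (((√x * w) ^ k * Real.exp (-(√x * w) ^ 2) : ℝ) : ℂ) *
      (laplaceRoot x (√x * w))⁻¹ = (√x : ℂ) ^ k * (√x : ℂ)⁻¹ * laplaceInt k x := by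
    rw [laplaceInt, ← integral_const_mul]
    refine setIntegral_congr_fun measurableSet_Ioi fun w hw => ?_
    rw [laplaceRoot_scale hx hw, mul_pow, mul_pow, Real.sq_sqrt hx.le, mul_inv]
    push_cast
    ring_nf
  rw [h2] at h
  have h3 := congrArg ((√x : ℂ) * ·) h
  simp only [Complex.real_smul, Complex.ofReal_inv] at h3
  rw [mul_inv_cancel_left₀ hs'] at h3
  rw [← h3]
  field_simp

theorem norm_gaussian_mul_inv_laplaceRoot_le (k : ℕ) (x : ℝ) {t : ℝ} (ht : 0 < t) :
    ‖((t ^ (k + 1) * Real.exp (-t ^ 2) : ℝ) : ℂ) * (laplaceRoot x t)⁻¹‖ ≤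
      t ^ k * Real.exp (-1 * t ^ 2) := by
  rw [norm_mul, Complex.norm_real, Real.norm_of_nonneg (by positivity), norm_inv]
  have h := self_le_norm_laplaceRoot x t
  calc t ^ (k + 1) * Real.exp (-t ^ 2) * ‖laplaceRoot x t‖⁻¹
      ≤ t ^ (k + 1) * Real.exp (-t ^ 2) * t⁻¹ := by gcongr
    _ = t ^ k * Real.exp (-1 * t ^ 2) := by rw [neg_one_mul]; field_simp; ring

theorem aestronglyMeasurable_gaussian_mul_inv_laplaceRoot (k : ℕ) {x : ℝ} (hx : 0 < x)
    (s : Set ℝ) : AEStronglyMeasurable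
      (fun t : ℝ => ((t ^ k * Real.exp (-t ^ 2) : ℝ) : ℂ) * (laplaceRoot x t)⁻¹)
      (volume.restrict s) := by
  have := continuous_laplaceRoot hx.ne'
  exact Continuous.aestronglyMeasurable (.mul (by fun_prop) (this.inv₀ fun t =>
    laplaceRoot_ne_zero (.inl hx.ne')))

theorem integral_self_mul_gaussian :
    ∫ t in Set.Ioi (0 : ℝ), t ^ 1 * Real.exp (-1 * t ^ 2) = 1 / 2 := by
  have := integral_rpow_mul_exp_neg_mul_rpow (p := 2) (q := 1) (b := 1) two_pos (by norm_num)
    one_pos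
  norm_num at this
  simpa using this

/-- After scaling, the root tends to `t`, leaving `∫ t e^{-t²} dt = 1/2`. -/
theorem tendsto_mul_laplaceInt_two :
    Tendsto (fun x : ℝ => (x : ℂ) * laplaceInt 2 x) (𝓝[>] 0) (𝓝 (1 / 2)) := by
  have h1 : Tendsto (fun x : ℝ => ∫ t in Set.Ioi (0 : ℝ),
      ((t ^ 2 * Real.exp (-t ^ 2) : ℝ) : ℂ) * (laplaceRoot x t)⁻¹) (𝓝[>] 0)
      (𝓝 (∫ t in Set.Ioi (0 : ℝ), ((t ^ 1 * Real.exp (-1 * t ^ 2) : ℝ) : ℂ))) := by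
    refine tendsto_integral_filter_of_dominated_convergence
      (fun t => t ^ 1 * Real.exp (-1 * t ^ 2)) ?_ ?_ (integrableOn_pow_mul_gaussian 1 one_pos) ?_
    · filter_upwards [self_mem_nhdsWithin] with x hx
      exact aestronglyMeasurable_gaussian_mul_inv_laplaceRoot 2 hx _
    · exact .of_forall fun x => (ae_restrict_iff' measurableSet_Ioi).2 (.of_forall fun t ht =>
        norm_gaussian_mul_inv_laplaceRoot_le 1 x ht)
    · refine (ae_restrict_iff' measurableSet_Ioi).2 (.of_forall fun t ht => ?_)
      have ht : 0 < t := ht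
      have h := ((continuousAt_laplaceRoot_left ht.ne').inv₀
        (laplaceRoot_ne_zero (.inr ht.ne'))).tendsto.const_mul
        ((t ^ 2 * Real.exp (-t ^ 2) : ℝ) : ℂ)
      refine (h.mono_left nhdsWithin_le_nhds).trans (le_of_eq (congrArg _ ?_))
      rw [Pi.inv_apply, laplaceRoot_zero_left ht]
      have : (t : ℂ) ≠ 0 := by exact_mod_cast ht.ne'
      push_cast
      rw [neg_one_mul]
      field_simp
  rw [integral_complex_ofReal, integral_self_mul_gaussian] at h1
  push_cast at h1
  refine h1.congr' ?_
  filter_upwards [self_mem_nhdsWithin] with x hx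
  have h := laplaceInt_scale 2 hx
  rw [← Complex.ofReal_pow, Real.sq_sqrt (le_of_lt hx)] at h
  rw [h]
  push_cast
  rfl

/-- A primitive of `t ↦ (t² - 2ix)^{-1/2}`. -/
noncomputable def laplacePrim (x t : ℝ) : ℂ := Complex.log (t + laplaceRoot x t)

theorem add_laplaceRoot_mem_slitPlane {x t : ℝ} (hx : x ≠ 0 ∨ t ≠ 0) (ht : 0 ≤ t) :
    (t : ℂ) + laplaceRoot x t ∈ Complex.slitPlane := by
  left
  have := laplaceRoot_re_pos hx
  simp only [Complex.add_re, Complex.ofReal_re]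
  positivity

theorem laplacePrim_hasDerivAt {x t : ℝ} (hx : x ≠ 0 ∨ t ≠ 0) (ht : 0 ≤ t) :
    HasDerivAt (laplacePrim x) (laplaceRoot x t)⁻¹ t := by
  have hs := add_laplaceRoot_mem_slitPlane hx ht
  have h1 := ((hasDerivAt_id t).ofReal_comp.add (laplaceRoot_hasDerivAt hx)).clog_real hs
  refine h1.congr_deriv ?_
  have := Complex.slitPlane_ne_zero hs
  have h0 := laplaceRoot_ne_zero hx
  simp only [id, Pi.add_apply]
  field_simp
  push_cast
  ring

theorem norm_laplacePrim_le {x t : ℝ} (hx : 0 < x) (hx1 : x ≤ 1) (ht : 0 < t) :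
    ‖laplacePrim x t‖ ≤ 1 / t + (2 * t + 6) := by
  have hre : t ≤ ‖(t : ℂ) + laplaceRoot x t‖ := by
    refine le_trans ?_ (Complex.re_le_norm _)
    have := laplaceRoot_re_pos (.inl hx.ne' : x ≠ 0 ∨ t ≠ 0)
    simp only [Complex.add_re, Complex.ofReal_re]
    linarith
  have hup : ‖(t : ℂ) + laplaceRoot x t‖ ≤ 2 * t + 2 := by
    refine (norm_add_le _ _).trans ?_
    have := norm_laplaceRoot_le hx.le hx1 ht.le
    rw [Complex.norm_real, Real.norm_of_nonneg ht.le]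
    linarith
  have hlog : |Real.log ‖(t : ℂ) + laplaceRoot x t‖| ≤ 1 / t + (2 * t + 2) := by
    have h0 : 0 < ‖(t : ℂ) + laplaceRoot x t‖ := ht.trans_le hre
    have h1 := Real.log_le_sub_one_of_pos h0
    have h2 := Real.one_sub_inv_le_log_of_pos h0
    -- Together with `1 - s⁻¹ ≤ log s ≤ s - 1` this gives a crude bound with a `1/t` singularity,
    -- harmless once multiplied by `2t e^{-t²}`.
    have h3 : ‖(t : ℂ) + laplaceRoot x t‖⁻¹ ≤ 1 / t := by rw [one_div]; gcongr
    rw [abs_le]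
    have : 0 < 1 / t := by positivity
    constructor <;> linarith
  have harg : |((t : ℂ) + laplaceRoot x t).arg| ≤ 4 :=
    (Complex.abs_arg_le_pi _).trans Real.pi_le_four
  rw [laplacePrim, Complex.log]
  refine (norm_add_le _ _).trans ?_
  simp only [norm_mul, Complex.norm_real, Complex.norm_I, mul_one, Real.norm_eq_abs]
  linarith

theorem norm_gaussian_mul_laplacePrim_le {x t : ℝ} (hx : 0 < x) (hx1 : x ≤ 1) (ht : 0 < t) :
    ‖((2 * t * Real.exp (-t ^ 2) : ℝ) : ℂ) * laplacePrim x t‖ ≤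
      2 * (t ^ 0 * Real.exp (-1 * t ^ 2)) + 12 * (t ^ 1 * Real.exp (-1 * t ^ 2)) +
        4 * (t ^ 2 * Real.exp (-1 * t ^ 2)) := by
  rw [norm_mul, Complex.norm_real, Real.norm_of_nonneg (by positivity)]
  calc 2 * t * Real.exp (-t ^ 2) * ‖laplacePrim x t‖
      ≤ 2 * t * Real.exp (-t ^ 2) * (1 / t + (2 * t + 6)) := by
        gcongr; exact norm_laplacePrim_le hx hx1 ht
    _ = _ := by rw [neg_one_mul]; field_simp; ring

theorem integrableOn_bound_gaussian_mul_laplacePrim : IntegrableOn (fun t : ℝ =>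
    2 * (t ^ 0 * Real.exp (-1 * t ^ 2)) + 12 * (t ^ 1 * Real.exp (-1 * t ^ 2)) +
        4 * (t ^ 2 * Real.exp (-1 * t ^ 2))) (Set.Ioi 0) :=
  (((integrableOn_pow_mul_gaussian 0 one_pos).const_mul 2).add
    ((integrableOn_pow_mul_gaussian 1 one_pos).const_mul 12)).add
    ((integrableOn_pow_mul_gaussian 2 one_pos).const_mul 4)

theorem continuousOn_laplacePrim {x : ℝ} (hx : 0 < x) :
    ContinuousOn (laplacePrim x) (Set.Ici 0) := fun _ ht =>
  (laplacePrim_hasDerivAt (.inl hx.ne') ht).continuousAt.continuousWithinAt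

theorem integrableOn_gaussian_mul_laplacePrim {x : ℝ} (hx : 0 < x) (hx1 : x ≤ 1) :
    IntegrableOn (fun t : ℝ => ((2 * t * Real.exp (-t ^ 2) : ℝ) : ℂ) * laplacePrim x t)
      (Set.Ioi 0) := by
  refine integrableOn_bound_gaussian_mul_laplacePrim.mono' ?_ ?_
  · exact (ContinuousOn.mul (by fun_prop) ((continuousOn_laplacePrim hx).mono
      Set.Ioi_subset_Ici_self)).aestronglyMeasurable measurableSet_Ioi
  · exact (ae_restrict_iff' measurableSet_Ioi).2 (.of_forall fun t ht =>
      norm_gaussian_mul_laplacePrim_le hx hx1 ht)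

/-- Integration by parts: the logarithmic divergence as `x → 0` is isolated in the boundary term
`laplacePrim x 0`, and the remaining integral converges. -/
theorem integral_gaussian_mul_inv_laplaceRoot {x : ℝ} (hx : 0 < x) (hx1 : x ≤ 1) :
    ∫ t in Set.Ioi (0 : ℝ), ((t ^ 0 * Real.exp (-t ^ 2) : ℝ) : ℂ) * (laplaceRoot x t)⁻¹ =
      (∫ t in Set.Ioi (0 : ℝ), ((2 * t * Real.exp (-t ^ 2) : ℝ) : ℂ) * laplacePrim x t)
        - laplacePrim x 0 := by
  let f : ℝ → ℂ := fun t => ((Real.exp (-t ^ 2) : ℝ) : ℂ) * laplacePrim x t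
  let f1 : ℝ → ℂ := fun t => ((t ^ 0 * Real.exp (-t ^ 2) : ℝ) : ℂ) * (laplaceRoot x t)⁻¹
  let f2 : ℝ → ℂ := fun t => ((2 * t * Real.exp (-t ^ 2) : ℝ) : ℂ) * laplacePrim x t
  have hf : ∀ t, 0 ≤ t → HasDerivAt f (f1 t - f2 t) t := fun t ht => by
    have h1 : HasDerivAt (fun t : ℝ => Real.exp (-t ^ 2)) (-(2 * t * Real.exp (-t ^ 2))) t := by
      refine (hasDerivAt_pow 2 t).neg.exp.congr_deriv ?_
      simp; ring
    refine (h1.ofReal_comp.mul (laplacePrim_hasDerivAt (.inl hx.ne') ht)).congr_deriv ?_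
    simp only [f1, f2]
    push_cast
    ring
  have hf1 : IntegrableOn f1 (Set.Ioi 0) := by
    refine ((integrableOn_pow_mul_gaussian 0 one_pos).mul_const (√(2 * x))⁻¹).mono' ?_ ?_
    · exact aestronglyMeasurable_gaussian_mul_inv_laplaceRoot 0 hx _
    · refine (ae_restrict_iff' measurableSet_Ioi).2 (.of_forall fun t ht => ?_)
      simp only [f1]
      rw [norm_mul, Complex.norm_real, Real.norm_of_nonneg (by positivity), norm_inv, neg_one_mul]
      have := sqrt_le_norm_laplaceRoot x t
      gcongr
  have hf2 : IntegrableOn f2 (Set.Ioi 0) := integrableOn_gaussian_mul_laplacePrim hx hx1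
  -- Only decay at infinity is needed, and for `t > 1` the factor `2t` exceeds `1`, so `f` is
  -- dominated by `f2`.
  have hfint : IntegrableOn f (Set.Ioi 1) := by
    refine (hf2.mono_set (Set.Ioi_subset_Ioi zero_le_one)).norm.mono' ?_ ?_
    · refine ((ContinuousOn.mul (by fun_prop) ((continuousOn_laplacePrim hx).mono
        fun t ht => ?_)).aestronglyMeasurable measurableSet_Ioi)
      exact zero_le_one.trans (le_of_lt (Set.mem_Ioi.1 ht))
    · refine (ae_restrict_iff' measurableSet_Ioi).2 (.of_forall fun t ht => ?_)
      have ht : 1 < t := ht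
      simp only [f, f2]
      rw [norm_mul, norm_mul, Complex.norm_real, Complex.norm_real,
        Real.norm_of_nonneg (by positivity), Real.norm_of_nonneg (by positivity)]
      gcongr
      have := Real.exp_pos (-t ^ 2)
      nlinarith
  have hlim := tendsto_zero_of_hasDerivAt_of_integrableOn_Ioi (a := 1)
    (fun t ht => hf t (zero_le_one.trans (le_of_lt ht)))
    ((hf1.sub hf2).mono_set (Set.Ioi_subset_Ioi zero_le_one)) hfint
  have key := integral_Ioi_of_hasDerivAt_of_tendsto (hf 0 le_rfl).continuousAt.continuousWithinAt
    (fun t ht => hf t (le_of_lt ht)) (hf1.sub hf2) hlim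
  rw [integral_sub hf1 hf2] at key
  have h0 : f 0 = laplacePrim x 0 := by simp [f]
  rw [h0] at key
  linear_combination key

theorem laplacePrim_zero {x : ℝ} (hx : 0 < x) : laplacePrim x 0 =
    ((Real.log (2 * x) / 2 : ℝ) : ℂ) - Complex.I * Real.pi / 4 := by
  have hlog : Complex.log (((0 : ℝ) : ℂ) ^ 2 - 2 * Complex.I * x) =
      (Real.log (2 * x) : ℂ) - Real.pi / 2 * Complex.I := by
    rw [show ((0 : ℝ) : ℂ) ^ 2 - 2 * Complex.I * x = ((2 * x : ℝ) : ℂ) * (-Complex.I) by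
      push_cast; ring, Complex.log_ofReal_mul (by positivity) (by simp), Complex.log_neg_I]
    ring
  rw [laplacePrim, laplaceRoot, Complex.cpow_def_of_ne_zero
    (Complex.slitPlane_ne_zero (radicand_mem_slitPlane (.inl hx.ne'))), hlog, Complex.ofReal_zero,
    zero_add, Complex.log_exp]
  · push_cast; ring
  -- The exponent has imaginary part `-π/4`, inside the principal strip.
  all_goals
    rw [show (1 / 2 : ℂ) = ((1 / 2 : ℝ) : ℂ) by push_cast; rfl, Complex.im_mul_ofReal]
    simp only [Complex.sub_im, Complex.ofReal_im, Complex.mul_im, Complex.I_im, Complex.I_re,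
      mul_zero, mul_one, add_zero, zero_sub]
    rw [show ((Real.pi : ℂ) / 2).re = Real.pi / 2 by
      rw [show (Real.pi : ℂ) / 2 = ((Real.pi / 2 : ℝ) : ℂ) by push_cast; rfl, Complex.ofReal_re]]
    linarith [Real.pi_pos]

/-- The left side is `Γ'(1)`, by differentiating Euler's integral. -/
theorem integral_log_mul_exp_neg :
    ∫ v in Set.Ioi (0 : ℝ), Real.log v * Real.exp (-v) = -Real.eulerMascheroniConstant := by
  have h1 := Complex.hasDerivAt_GammaIntegral (s := 1) (by simp)
  have h2 : HasDerivAt Complex.Gamma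
      (∫ t in Set.Ioi (0 : ℝ), (t : ℂ) ^ ((1 : ℂ) - 1) * (Real.log t * Real.exp (-t))) 1 := by
    refine h1.congr_of_eventuallyEq ?_
    have : ∀ᶠ s : ℂ in 𝓝 1, 0 < s.re :=
      Complex.continuous_re.continuousAt.eventually (lt_mem_nhds (by simp))
    filter_upwards [this] with s hs using Complex.Gamma_eq_integral hs
  have h3 := h2.unique Complex.hasDerivAt_Gamma_one
  simp only [sub_self, Complex.cpow_zero, one_mul, ← Complex.ofReal_mul] at h3
  rw [integral_complex_ofReal] at h3
  exact_mod_cast h3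

theorem integral_gaussian_mul_log : ∫ t in Set.Ioi (0 : ℝ), 2 * t * Real.exp (-t ^ 2) *
    Real.log (2 * t) = Real.log 2 - Real.eulerMascheroniConstant / 2 := by
  have h := integral_comp_rpow_Ioi (fun v : ℝ => Real.exp (-v) * Real.log 2 +
    1 / 2 * (Real.log v * Real.exp (-v))) (p := 2) two_ne_zero
  have hi : IntegrableOn (fun v : ℝ => Real.exp (-v)) (Set.Ioi 0) := integrableOn_exp_neg_Ioi 0
  have hl : IntegrableOn (fun v : ℝ => Real.log v * Real.exp (-v)) (Set.Ioi 0) := by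
    -- A non-integrable function has integral `0` by convention, whereas the value here is `-γ ≠ 0`.
    by_contra hn
    have h0 := integral_undef hn
    rw [integral_log_mul_exp_neg] at h0
    have := Real.one_half_lt_eulerMascheroniConstant
    linarith
  rw [integral_add (hi.mul_const _) (hl.const_mul _), integral_mul_const, integral_const_mul,
    integral_log_mul_exp_neg, integral_exp_neg_Ioi_zero] at h
  rw [show Real.log 2 - Real.eulerMascheroniConstant / 2 = 1 * Real.log 2 +
    1 / 2 * -Real.eulerMascheroniConstant by ring, ← h]
  refine setIntegral_congr_fun measurableSet_Ioi fun t ht => ?_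
  have ht : 0 < t := ht
  simp only [abs_two, smul_eq_mul, Real.rpow_two]
  rw [Real.log_mul two_ne_zero ht.ne', Real.log_pow, show (2 : ℝ) - 1 = 1 by norm_num,
    Real.rpow_one]
  push_cast
  ring

/-- The boundary term gives `-log(2x)/2 + iπ/4`; the remaining integral tends to `∫ 2t e^{-t²}
log(2t) dt`, where `γ` enters. -/
theorem tendsto_laplaceInt_zero :
    Tendsto (fun x : ℝ => laplaceInt 0 x + ((Real.log (2 * x) / 2 : ℝ) : ℂ)) (𝓝[>] 0)
      (𝓝 (((Real.log 2 - Real.eulerMascheroniConstant / 2 : ℝ) : ℂ) +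
        Complex.I * Real.pi / 4)) := by
  have hev : ∀ᶠ x : ℝ in 𝓝[>] 0, x ∈ Set.Ioc (0 : ℝ) 1 := Ioc_mem_nhdsGT one_pos
  have h1 : Tendsto (fun x : ℝ => ∫ t in Set.Ioi (0 : ℝ),
      ((2 * t * Real.exp (-t ^ 2) : ℝ) : ℂ) * laplacePrim x t) (𝓝[>] 0)
      (𝓝 (∫ t in Set.Ioi (0 : ℝ), ((2 * t * Real.exp (-t ^ 2) * Real.log (2 * t) : ℝ) : ℂ))) := by
    refine tendsto_integral_filter_of_dominated_convergence _ ?_ ?_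
      integrableOn_bound_gaussian_mul_laplacePrim ?_
    · filter_upwards [hev] with x hx
      exact (integrableOn_gaussian_mul_laplacePrim hx.1 hx.2).aestronglyMeasurable
    · filter_upwards [hev] with x hx
      exact (ae_restrict_iff' measurableSet_Ioi).2 (.of_forall fun t ht =>
        norm_gaussian_mul_laplacePrim_le hx.1 hx.2 ht)
    · refine (ae_restrict_iff' measurableSet_Ioi).2 (.of_forall fun t ht => ?_)
      have ht : 0 < t := ht
      have h := (((continuousAt_laplaceRoot_left ht.ne').const_add (t : ℂ)).clog
        (add_laplaceRoot_mem_slitPlane (.inr ht.ne') ht.le)).tendsto.const_mul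
        ((2 * t * Real.exp (-t ^ 2) : ℝ) : ℂ)
      refine (h.mono_left nhdsWithin_le_nhds).trans (le_of_eq (congrArg _ ?_))
      rw [laplaceRoot_zero_left ht, ← two_mul,
        show (2 * (t : ℂ)) = ((2 * t : ℝ) : ℂ) by push_cast; rfl,
        ← Complex.ofReal_log (by positivity), ← Complex.ofReal_mul]
  rw [integral_complex_ofReal, integral_gaussian_mul_log] at h1
  refine (h1.add_const (Complex.I * Real.pi / 4)).congr' ?_
  filter_upwards [hev] with x hx
  have h2 := laplaceInt_scale 0 hx.1
  rw [integral_gaussian_mul_inv_laplaceRoot hx.1 hx.2, laplacePrim_zero hx.1, pow_zero,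
    one_mul] at h2
  rw [h2]
  ring

/-! ### Laplace representation of the Hankel functions -/

/-- The Laplace integral representing `H_0^{(1)}`. -/
noncomputable def laplaceHankelZero (x : ℝ) : ℂ :=
  -(4 * Complex.I / Real.pi * Complex.exp (Complex.I * x)) * laplaceInt 0 x

/-- The Laplace integral representing `H_1^{(1)}`. -/
noncomputable def laplaceHankelOne (x : ℝ) : ℂ :=
  (4 * Complex.I / Real.pi * Complex.exp (Complex.I * x)) *
    (Complex.I * laplaceInt 0 x - laplaceInt 2 x)

theorem exp_I_mul_hasDerivAt (x : ℝ) : HasDerivAt (fun x : ℝ => Complex.exp (Complex.I * x))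
    (Complex.I * Complex.exp (Complex.I * x)) x := by
  have := ((hasDerivAt_id x).ofReal_comp.const_mul Complex.I).cexp
  simpa [mul_comm] using this

theorem laplaceHankelZero_hasDerivAt {x : ℝ} (hx : 0 < x) :
    HasDerivAt laplaceHankelZero (-laplaceHankelOne x) x := by
  refine ((((exp_I_mul_hasDerivAt x).const_mul (4 * Complex.I / Real.pi)).neg).mul
    (laplaceInt_hasDerivAt 0 hx)).congr_deriv ?_
  simp only [laplaceHankelOne, Pi.neg_apply]
  ring

theorem mul_laplaceHankelOne_hasDerivAt {x : ℝ} (hx : 0 < x) :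
    HasDerivAt (fun x : ℝ => (x : ℂ) * laplaceHankelOne x) (x * laplaceHankelZero x) x := by
  have h := (hasDerivAt_id x).ofReal_comp.mul
    (((exp_I_mul_hasDerivAt x).const_mul (4 * Complex.I / Real.pi)).mul
    (((laplaceInt_hasDerivAt 0 hx).const_mul Complex.I).sub (laplaceInt_hasDerivAt 2 hx)))
  refine h.congr_deriv ?_
  have hr := laplaceInt_recurrence hx
  simp only [laplaceHankelZero, id, Pi.sub_apply, Pi.mul_apply]
  push_cast
  linear_combination (-(4 * Complex.I / Real.pi * Complex.exp (Complex.I * x))) * hr +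
    (4 * Complex.I / Real.pi * Complex.exp (Complex.I * x)) * (x * laplaceInt 0 x) * Complex.I_sq

theorem tendsto_mul_laplaceInt_zero :
    Tendsto (fun x : ℝ => (x : ℂ) * laplaceInt 0 x) (𝓝[>] 0) (𝓝 0) := by
  have hx := (Complex.continuous_ofReal.tendsto 0).comp tendsto_id_nhdsGT_zero
  have h1 := hx.mul tendsto_laplaceInt_zero
  have hlog : Tendsto (fun x : ℝ => x * Real.log (2 * x) / 2) (𝓝[>] 0) (𝓝 0) := by
    have : Continuous fun x : ℝ => (2 * x) * Real.log (2 * x) / 4 := by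
      have := Real.continuous_mul_log.comp (continuous_const_mul (2 : ℝ))
      exact this.div_const 4
    have h := (this.tendsto 0).mono_left (nhdsWithin_le_nhds (s := Set.Ioi 0))
    simp only [mul_zero, zero_mul, zero_div] at h
    exact h.congr fun x => by ring
  have h2 := h1.sub ((Complex.continuous_ofReal.tendsto 0).comp hlog)
  simp only [Complex.ofReal_zero, zero_mul, sub_zero] at h2
  refine h2.congr fun x => ?_
  simp only [Function.comp]
  push_cast
  ring

theorem tendsto_laplaceHankelZero :
    Tendsto (fun x : ℝ => laplaceHankelZero x -
      (1 + Complex.I * ((2 / Real.pi * (Real.log (x / 2) + Real.eulerMascheroniConstant) : ℝ) : ℂ)))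
      (𝓝[>] 0) (𝓝 0) := by
  -- The phase may be replaced by `1`: `|e^{ix} - 1| ≤ x` and `x L₀(x) → 0`.
  have h1 : Tendsto (fun x : ℝ => (Complex.exp (Complex.I * x) - 1) * laplaceInt 0 x)
      (𝓝[>] 0) (𝓝 0) := by
    refine squeeze_zero_norm (fun x => ?_) (tendsto_norm_zero.comp tendsto_mul_laplaceInt_zero)
    simp only [Function.comp]
    rw [norm_mul, norm_mul]
    gcongr
    rw [Complex.norm_real]
    exact Real.norm_exp_I_mul_ofReal_sub_one_le
  have hpi : (Real.pi : ℂ) ≠ 0 := by exact_mod_cast Real.pi_ne_zero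
  have h2 := (((h1.add tendsto_laplaceInt_zero).const_mul (-(4 * Complex.I / Real.pi))).add_const
    (2 * Complex.I / Real.pi * ((2 * Real.log 2 - Real.eulerMascheroniConstant : ℝ) : ℂ))).sub_const
    1
  have h0 : -(4 * Complex.I / Real.pi) * (0 + (((Real.log 2 - Real.eulerMascheroniConstant / 2 : ℝ)
      : ℂ) + Complex.I * Real.pi / 4)) + 2 * Complex.I / Real.pi *
      ((2 * Real.log 2 - Real.eulerMascheroniConstant : ℝ) : ℂ) - 1 = 0 := by
    push_cast
    field_simp
    linear_combination (-2 * (Real.pi : ℂ)) * Complex.I_sq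
  rw [h0] at h2
  refine h2.congr' ?_
  filter_upwards [self_mem_nhdsWithin] with x hx
  have hx : 0 < x := hx
  rw [Real.log_mul two_ne_zero hx.ne', Real.log_div hx.ne' two_ne_zero, laplaceHankelZero]
  push_cast
  ring

theorem tendsto_mul_laplaceHankelOne :
    Tendsto (fun x : ℝ => (x : ℂ) * laplaceHankelOne x) (𝓝[>] 0)
      (𝓝 (-(2 * Complex.I / Real.pi))) := by
  have he : Tendsto (fun x : ℝ => Complex.exp (Complex.I * x)) (𝓝[>] 0) (𝓝 1) := by
    have : Continuous fun x : ℝ => Complex.exp (Complex.I * x) := by fun_prop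
    have h := (this.tendsto 0).mono_left (nhdsWithin_le_nhds (s := Set.Ioi 0))
    simpa using h
  have h := (he.const_mul (4 * Complex.I / Real.pi)).mul
    ((tendsto_mul_laplaceInt_zero.const_mul Complex.I).sub tendsto_mul_laplaceInt_two)
  refine (h.congr fun x => ?_).trans (le_of_eq (congrArg _ ?_))
  · rw [laplaceHankelOne]; ring
  · ring

/-- The energy `|D|² + |D₁|²` has derivative `-(2/x)|D₁|² ≤ 0` and tends to `0` at the origin, so it
vanishes identically. -/
theorem eq_zero_of_bessel_system {D D₁ : ℝ → ℂ} (hD : ∀ x, 0 < x → HasDerivAt D (-D₁ x) x)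
    (hD₁ : ∀ x : ℝ, 0 < x → HasDerivAt (fun x : ℝ => (x : ℂ) * D₁ x) (x * D x) x)
    (h0 : Tendsto D (𝓝[>] 0) (𝓝 0))
    (h1 : Tendsto (fun x : ℝ => (x : ℂ) * D₁ x) (𝓝[>] 0) (𝓝 0)) {x : ℝ} (hx : 0 < x) :
    D x = 0 ∧ D₁ x = 0 := by
  have hD₁' : ∀ x : ℝ, 0 < x → HasDerivAt D₁ (D x - (1 / x : ℝ) • D₁ x) x := fun x hx => by
    have hx' : (x : ℂ) ≠ 0 := by exact_mod_cast hx.ne'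
    have h := ((hasDerivAt_inv hx.ne').ofReal_comp.mul (hD₁ x hx))
    refine (h.congr_deriv ?_).congr_of_eventuallyEq ?_
    · rw [Complex.real_smul]
      push_cast
      field_simp
      ring
    · filter_upwards [lt_mem_nhds hx] with y hy
      have : (y : ℂ) ≠ 0 := by exact_mod_cast hy.ne'
      simp only [Pi.mul_apply]
      push_cast
      field_simp
  -- The hypothesis only controls `x D₁`. But `(x D₁)' = x D` is at most `x ε` in norm on `(0, x]`,
  -- so the mean value inequality gives `|x D₁| ≤ ε x²`.
  have hlim : Tendsto D₁ (𝓝[>] 0) (𝓝 0) := by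
    rw [Metric.tendsto_nhds]
    intro ε hε
    obtain ⟨δ, hδ, hball⟩ := mem_nhdsGT_iff_exists_Ioo_subset.1 (Metric.tendsto_nhds.1 h0 ε hε)
    have hδ : 0 < δ := hδ
    have hmem : Set.Ioo 0 (min δ 1) ∈ 𝓝[>] (0 : ℝ) := Ioo_mem_nhdsGT (by positivity)
    filter_upwards [hmem] with x hx
    have hx1 : x < 1 := hx.2.trans_le (min_le_right _ _)
    have hxδ : x < δ := hx.2.trans_le (min_le_left _ _)
    have hx0 : 0 < x := hx.1
    have hle : ‖(x : ℂ) * D₁ x - 0‖ ≤ x * ε * x := by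
      refine le_of_tendsto ((tendsto_const_nhds.sub h1).norm) ?_
      filter_upwards [Ioo_mem_nhdsGT hx0] with y hy
      have := Convex.norm_image_sub_le_of_norm_hasDerivWithin_le
        (f := fun x : ℝ => (x : ℂ) * D₁ x) (f' := fun x : ℝ => (x : ℂ) * D x) (C := x * ε)
        (s := Set.Icc y x) (x := y) (y := x)
        (fun z hz => (hD₁ z (hy.1.trans_le hz.1)).hasDerivWithinAt)
        (fun z hz => ?_) (convex_Icc _ _) ⟨le_rfl, hy.2.le⟩ ⟨hy.2.le, le_rfl⟩
      · refine this.trans ?_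
        rw [Real.norm_of_nonneg (sub_nonneg.2 hy.2.le)]
        gcongr
        linarith [hy.1]
      · have hz0 : 0 < z := hy.1.trans_le hz.1
        have h2 : dist (D z) 0 < ε := hball ⟨hz0, hz.2.trans_lt hxδ⟩
        rw [dist_zero_right] at h2
        rw [norm_mul, Complex.norm_real, Real.norm_of_nonneg hz0.le]
        gcongr
        exact hz.2
    rw [sub_zero, norm_mul, Complex.norm_real, Real.norm_of_nonneg hx0.le] at hle
    rw [dist_zero_right]
    have h3 : ‖D₁ x‖ ≤ ε * x := by
      rw [mul_assoc] at hle
      exact le_of_mul_le_mul_left hle hx0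
    nlinarith
  have hanti : AntitoneOn (fun x => ‖D x‖ ^ 2 + ‖D₁ x‖ ^ 2) (Set.Ioi 0) := by
    refine antitoneOn_of_hasDerivWithinAt_nonpos (f' := fun x => -(2 / x) * ‖D₁ x‖ ^ 2)
      (convex_Ioi 0) (fun x hx => ?_) (fun x hx => ?_) (fun x hx => ?_)
    · exact ((hD x hx).continuousAt.norm.pow 2 |>.add
        ((hD₁' x hx).continuousAt.norm.pow 2)).continuousWithinAt
    · rw [interior_Ioi] at hx
      refine (((hD x hx).norm_sq.add (hD₁' x hx).norm_sq).congr_deriv ?_).hasDerivWithinAt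
      rw [inner_neg_right, inner_sub_right, real_inner_smul_right, real_inner_self_eq_norm_sq,
        real_inner_comm (D x)]
      ring
    · rw [interior_Ioi] at hx
      have hx : 0 < x := hx
      have : 0 ≤ 2 / x * ‖D₁ x‖ ^ 2 := by positivity
      linarith
  have hle : ‖D x‖ ^ 2 + ‖D₁ x‖ ^ 2 ≤ 0 := by
    have ht : Tendsto (fun x => ‖D x‖ ^ 2 + ‖D₁ x‖ ^ 2) (𝓝[>] 0) (𝓝 0) := by
      simpa using (h0.norm.pow 2).add (hlim.norm.pow 2)
    refine ge_of_tendsto ht ?_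
    filter_upwards [Ioo_mem_nhdsGT hx] with y hy using hanti hy.1 hx hy.2.le
  have ha := sq_nonneg ‖D x‖
  have hb := sq_nonneg ‖D₁ x‖
  exact ⟨by simpa using (show ‖D x‖ ^ 2 = 0 by linarith),
    by simpa using (show ‖D₁ x‖ ^ 2 = 0 by linarith)⟩

theorem hankel1_eq_laplace {x : ℝ} (hx : 0 < x) :
    hankel1 0 x = laplaceHankelZero x ∧ hankel1 1 x = laplaceHankelOne x := by
  have h := eq_zero_of_bessel_system (D := fun x => hankel1 0 x - laplaceHankelZero x)
    (D₁ := fun x => hankel1 1 x - laplaceHankelOne x)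
    (fun x hx => ((hankel1_zero_hasDerivAt hx).sub
      (laplaceHankelZero_hasDerivAt hx)).congr_deriv (by ring))
    (fun x hx => (((mul_hankel1_one_hasDerivAt hx).sub
      (mul_laplaceHankelOne_hasDerivAt hx)).congr_deriv (by ring)).congr_of_eventuallyEq
      (.of_forall fun y => by simp only [Pi.sub_apply]; ring))
    (by
      have := tendsto_hankel1_zero.sub tendsto_laplaceHankelZero
      rw [sub_zero] at this
      exact this.congr fun x => by ring)
    (by
      have := tendsto_mul_hankel1_one.sub tendsto_mul_laplaceHankelOne
      rw [sub_self] at this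
      exact this.congr fun x => by ring) hx
  exact ⟨sub_eq_zero.1 h.1, sub_eq_zero.1 h.2⟩

/-! ### Modulus bounds -/

theorem norm_laplaceInt_zero_le {x : ℝ} (hx : 0 < x) :
    ‖laplaceInt 0 x‖ ≤ √(Real.pi / x) / 2 * (√2)⁻¹ := by
  have := norm_laplaceInt_le 0 hx
  simpa only [pow_zero, one_mul, integral_gaussian_Ioi] using this

theorem integral_sq_mul_gaussian {x : ℝ} (hx : 0 < x) :
    ∫ w in Set.Ioi (0 : ℝ), w ^ 2 * Real.exp (-x * w ^ 2) = √(Real.pi / x) / (4 * x) := by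
  have h := integral_rpow_mul_exp_neg_mul_rpow (p := 2) (q := 2) two_pos (by norm_num) hx
  simp only [Real.rpow_two] at h
  rw [h, show ((2 : ℝ) + 1) / 2 = 1 / 2 + 1 by norm_num, Real.Gamma_add_one (by norm_num),
    Real.Gamma_one_half_eq, show -((2 : ℝ) + 1) / 2 = -(1 / 2) - 1 by norm_num,
    Real.rpow_sub_one hx.ne', Real.rpow_neg hx.le, ← Real.sqrt_eq_rpow,
    Real.sqrt_div Real.pi_pos.le]
  have := Real.sqrt_pos.2 hx
  field_simp
  norm_num

theorem norm_laplaceInt_two_le {x : ℝ} (hx : 0 < x) :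
    ‖laplaceInt 2 x‖ ≤ √(Real.pi / x) / (4 * x) * (√2)⁻¹ := by
  have := norm_laplaceInt_le 2 hx
  rwa [integral_sq_mul_gaussian hx] at this

theorem norm_laplace_prefactor (x : ℝ) :
    ‖4 * Complex.I / Real.pi * Complex.exp (Complex.I * x)‖ = 4 / Real.pi := by
  rw [mul_comm Complex.I (x : ℂ), norm_mul, Complex.norm_exp_ofReal_mul_I]
  simp [abs_of_pos Real.pi_pos]

theorem norm_hankel1_zero_le_sqrt {x : ℝ} (hx : 0 < x) :
    ‖hankel1 0 x‖ ≤ √(2 / (Real.pi * x)) := by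
  have hpi := Real.pi_pos
  rw [(hankel1_eq_laplace hx).1, laplaceHankelZero, norm_mul, norm_neg, norm_laplace_prefactor]
  have h := norm_laplaceInt_zero_le hx
  calc 4 / Real.pi * ‖laplaceInt 0 x‖ ≤ 4 / Real.pi * (√(Real.pi / x) / 2 * (√2)⁻¹) := by gcongr
    _ = √(2 / (Real.pi * x)) := by
      have h1 := Real.sq_sqrt (show 0 ≤ Real.pi / x by positivity)
      have h2 := Real.sq_sqrt (show (0 : ℝ) ≤ 2 by norm_num)
      rw [eq_comm, Real.sqrt_eq_iff_eq_sq (by positivity) (by positivity), mul_pow, mul_pow,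
        div_pow _ (2 : ℝ), h1, inv_pow, h2]
      field_simp
      norm_num

theorem inner_hankel1_le {x : ℝ} (hx : 0 < x) :
    inner ℝ (hankel1 1 x) (hankel1 0 x) ≤ 1 / (Real.pi * x ^ 2) := by
  have hpi := Real.pi_pos
  -- The common factor scales the inner product by its squared modulus, and `⟨i L₀, L₀⟩ = 0` removes
  -- the other term of `H₁`.
  have key : inner ℝ (hankel1 1 x) (hankel1 0 x) =
      (4 / Real.pi) ^ 2 * inner ℝ (laplaceInt 2 x) (laplaceInt 0 x) := by
    rw [(hankel1_eq_laplace hx).1, (hankel1_eq_laplace hx).2, laplaceHankelZero, laplaceHankelOne,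
      ← norm_laplace_prefactor x, ← Complex.normSq_eq_norm_sq]
    generalize 4 * Complex.I / Real.pi * Complex.exp (Complex.I * x) = a
    simp only [Complex.inner, Complex.normSq_apply, Complex.mul_re, Complex.mul_im, Complex.conj_re,
      Complex.conj_im, Complex.sub_re, Complex.sub_im, Complex.I_re, Complex.I_im, Complex.neg_re,
      Complex.neg_im]
    ring
  rw [key]
  have h1 := (real_inner_le_norm (laplaceInt 2 x) (laplaceInt 0 x)).trans
    (mul_le_mul (norm_laplaceInt_two_le hx) (norm_laplaceInt_zero_le hx) (norm_nonneg _)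
      (by positivity))
  refine (mul_le_mul_of_nonneg_left h1 (by positivity)).trans (le_of_eq ?_)
  have h1 := Real.sq_sqrt (show 0 ≤ Real.pi / x by positivity)
  have h2 := Real.sq_sqrt (show (0 : ℝ) ≤ 2 by norm_num)
  calc _ = (4 / Real.pi) ^ 2 * (√(Real.pi / x) ^ 2 / (8 * x) * (√2 ^ 2)⁻¹) := by
        field_simp; ring
    _ = _ := by rw [h1, h2]; field_simp; norm_num

theorem norm_hankel1_one_le {x : ℝ} (hx : 0 < x) :
    ‖hankel1 1 x‖ ≤ √(2 / (Real.pi * x) + 4 / (Real.pi ^ 2 * x ^ 2)) := by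
  have hpi := Real.pi_pos
  -- `V' = 2x²⟨H₁, H₀⟩ - 2/π ≤ 0`, so `V` stays below its limit `4/π²` at `0⁺`.
  let V : ℝ → ℝ := fun x => ‖(x : ℂ) * hankel1 1 x‖ ^ 2 - 2 / Real.pi * x
  have hV : ∀ x, 0 < x → HasDerivAt V
      (2 * x ^ 2 * inner ℝ (hankel1 1 x) (hankel1 0 x) - 2 / Real.pi) x := fun x hx => by
    refine (((mul_hankel1_one_hasDerivAt hx).norm_sq).sub
      ((hasDerivAt_id x).const_mul (2 / Real.pi))).congr_deriv ?_
    rw [← Complex.real_smul, ← Complex.real_smul, real_inner_smul_left, real_inner_smul_right]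
    ring
  have hanti : AntitoneOn V (Set.Ioi 0) := by
    refine antitoneOn_of_hasDerivWithinAt_nonpos (f' := fun x => 2 * x ^ 2 *
      inner ℝ (hankel1 1 x) (hankel1 0 x) - 2 / Real.pi)
      (convex_Ioi 0) (fun x hx => (hV x hx).continuousAt.continuousWithinAt)
      (fun x hx => ?_) (fun x hx => ?_)
    · rw [interior_Ioi] at hx
      exact (hV x hx).hasDerivWithinAt
    · rw [interior_Ioi] at hx
      have hx : 0 < x := hx
      have := mul_le_mul_of_nonneg_left (inner_hankel1_le hx) (show 0 ≤ 2 * x ^ 2 by positivity)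
      have h2 : 2 * x ^ 2 * (1 / (Real.pi * x ^ 2)) = 2 / Real.pi := by field_simp
      linarith
  have ht : Tendsto V (𝓝[>] 0) (𝓝 (4 / Real.pi ^ 2)) := by
    have h := (tendsto_mul_hankel1_one.norm.pow 2).sub
      (tendsto_id_nhdsGT_zero.const_mul (2 / Real.pi))
    refine h.trans (le_of_eq (congrArg _ ?_))
    simp [abs_of_pos hpi]
    ring
  have hle : V x ≤ 4 / Real.pi ^ 2 := by
    refine ge_of_tendsto ht ?_
    filter_upwards [Ioo_mem_nhdsGT hx] with y hy using hanti hy.1 hx hy.2.le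
  simp only [V] at hle
  rw [norm_mul, Complex.norm_real, Real.norm_of_nonneg hx.le, mul_pow] at hle
  refine Real.le_sqrt_of_sq_le ?_
  have : 2 / (Real.pi * x) + 4 / (Real.pi ^ 2 * x ^ 2) =
      (4 / Real.pi ^ 2 + 2 / Real.pi * x) / x ^ 2 := by field_simp; ring
  rw [this, le_div_iff₀ (by positivity)]
  linarith

/-! ### Logarithmic bound for `H₀` near the origin -/

theorem abs_seriesSum_le {a : ℕ → ℝ} {C y : ℝ} (hC : ∀ m, |a m| ≤ C / m.factorial) (hy : 0 ≤ y) :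
    |seriesSum a y| ≤ C * Real.exp y := by
  have h := (Real.summable_pow_div_factorial y).mul_left C
  rw [Real.exp_eq_exp_ℝ, NormedSpace.exp_eq_tsum_div, ← tsum_mul_left]
  refine tsum_of_norm_bounded (f := fun m => a m * y ^ m) h.hasSum fun m => ?_
  rw [norm_mul, norm_pow, Real.norm_eq_abs, Real.norm_of_nonneg hy]
  calc |a m| * y ^ m ≤ C / m.factorial * y ^ m := by gcongr; exact hC m
    _ = C * (y ^ m / m.factorial) := by ring

theorem abs_besselJ_zero_sub_le {y : ℝ} (hy : 0 ≤ y) :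
    |seriesSum (besselJCoeff 0) y - (1 - y)| ≤ y ^ 2 * (1 / 4 * Real.exp y) := by
  rw [(besselJCoeff_decay 0).seriesSum_eq_add y (fun m => rfl),
    (besselJCoeff_decay 0).shift.seriesSum_eq_add y (fun m => rfl)]
  have h : |seriesSum (fun m => besselJCoeff 0 (m + 1 + 1)) y| ≤ 1 / 4 * Real.exp y := by
    refine abs_seriesSum_le (fun m => ?_) hy
    rw [besselJCoeff, abs_div, abs_pow, abs_neg, abs_one, one_pow, abs_of_pos (by positivity),
      div_div]
    refine one_div_le_one_div_of_le (by positivity) ?_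
    have h1 : (2 : ℝ) ≤ (m + 1 + 1).factorial := by
      exact_mod_cast (show Nat.factorial 2 ≤ _ from Nat.factorial_le (by omega))
    have h2 : 2 * (m.factorial : ℝ) ≤ (m + 1 + 1).factorial := by
      rw [Nat.factorial_succ, Nat.factorial_succ]
      have : 2 ≤ (m + 1 + 1) * (m + 1) := by nlinarith
      exact_mod_cast (by nlinarith [m.factorial_pos] :
        2 * m.factorial ≤ (m + 1 + 1) * ((m + 1) * m.factorial))
    rw [add_zero]
    calc (4 : ℝ) * m.factorial = 2 * (2 * m.factorial) := by ring
      _ ≤ _ := by gcongr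
  rw [show besselJCoeff 0 0 + y * (besselJCoeff 0 (0 + 1) + y *
    seriesSum (fun m => besselJCoeff 0 (m + 1 + 1)) y) - (1 - y) = y ^ 2 *
    seriesSum (fun m => besselJCoeff 0 (m + 1 + 1)) y by simp [besselJCoeff]; ring,
    abs_mul, abs_of_nonneg (by positivity)]
  gcongr

theorem abs_seriesSum_besselYCoeffZero_le {y : ℝ} (hy : 0 ≤ y) :
    |seriesSum besselYCoeffZero y| ≤ y * (1 * Real.exp y) := by
  rw [besselYCoeffZero_decay.seriesSum_eq_add y (fun m => rfl)]
  have h : |seriesSum (fun m => besselYCoeffZero (m + 1)) y| ≤ 1 * Real.exp y := by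
    refine abs_seriesSum_le (fun m => ?_) hy
    obtain h := harmonic_le_self (m + 1)
    rw [besselYCoeffZero, abs_div, abs_mul, abs_pow, abs_neg, abs_one, one_pow, one_mul,
      abs_of_nonneg (harmonic_nonneg _), abs_of_pos (by positivity),
      div_le_div_iff₀ (by positivity) (by positivity), one_mul]
    calc (harmonic (m + 1) : ℝ) * m.factorial ≤ ((m + 1 : ℕ) : ℝ) * m.factorial := by gcongr
      _ = (m + 1).factorial := by rw [Nat.factorial_succ]; push_cast; ring
      _ ≤ _ := le_mul_of_one_le_left (by positivity) (one_le_factorial_real _)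
  rw [show besselYCoeffZero 0 = 0 by simp [besselYCoeffZero], zero_add, abs_mul, abs_of_nonneg hy]
  gcongr

theorem norm_hankel1_zero_le_log {x : ℝ} (hx : 0 < x) : ‖hankel1 0 x‖ ≤
    1 + 2 / Real.pi * |Real.log (x / 2) + Real.eulerMascheroniConstant| := by
  have hpi := Real.pi_pos
  set A := |Real.log (x / 2) + Real.eulerMascheroniConstant| with hA
  have hA0 : 0 ≤ A := abs_nonneg _
  -- Beyond `2/π` the square-root bound is already at most `1`.
  rcases le_total (2 / Real.pi) x with h | h
  · refine (norm_hankel1_zero_le_sqrt hx).trans ?_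
    have h1 : √(2 / (Real.pi * x)) ≤ 1 := by
      refine Real.sqrt_le_one.mpr ?_
      rw [div_le_one (by positivity)]
      rwa [div_le_iff₀' hpi] at h
    have : 0 ≤ 2 / Real.pi * A := by positivity
    linarith
  -- For small `x`, `J₀` lies below `1` by at least `0.96 y`, which pays for the error of at most
  -- `(2/π) · 1.2 y ≤ 0.768 y` in `Y₀`.
  · set y := x ^ 2 / 4 with hy
    have hy0 : 0 ≤ y := by positivity
    have hpi3 := Real.pi_gt_d2
    have hx1 : x ≤ 0.64 := h.trans (by rw [div_le_iff₀ hpi]; linarith)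
    have hy1 : y ≤ 0.11 := by rw [hy]; nlinarith
    have hexp : Real.exp y ≤ 1.2 := by
      have := Real.add_one_le_exp (-y)
      rw [Real.exp_neg] at this
      have h3 : (Real.exp y)⁻¹ ≥ 0.89 := by linarith
      have h4 := Real.exp_pos y
      have h5 := mul_inv_cancel₀ h4.ne'
      nlinarith
    have hJ := abs_besselJ_zero_sub_le hy0
    rw [hy, ← besselJ_zero_eq, ← hy, abs_le] at hJ
    have hh := abs_seriesSum_besselYCoeffZero_le hy0
    have hB : y ^ 2 * (1 / 4 * Real.exp y) ≤ 0.04 * y := by nlinarith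
    have hJ0 : 0 ≤ besselJ 0 x := by linarith [hJ.1]
    have hJ1 : besselJ 0 x ≤ 1 - 0.96 * y := by linarith [hJ.2]
    have hY : |besselY 0 x| ≤ 2 / Real.pi * (A * besselJ 0 x + 1.2 * y) := by
      rw [besselY_zero_eq, abs_mul, abs_of_pos (by positivity)]
      gcongr
      refine (abs_sub _ _).trans ?_
      rw [abs_mul, abs_of_nonneg hJ0]
      have : y * (1 * Real.exp y) ≤ 1.2 * y := by nlinarith
      linarith
    have hn : ‖hankel1 0 x‖ ≤ besselJ 0 x + |besselY 0 x| := by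
      refine (norm_add_le _ _).trans ?_
      simp [abs_of_nonneg hJ0]
    have h2pi : 2 / Real.pi ≤ 0.64 := by rw [div_le_iff₀ hpi]; linarith
    have h3 : 2 / Real.pi * (1.2 * y) ≤ 0.64 * (1.2 * y) := by gcongr
    have h4 : 2 / Real.pi * (A * besselJ 0 x) ≤ 2 / Real.pi * (A * 1) := by
      gcongr
      linarith
    linarith

/-! ### Decreasing majorants of the Hankel functions -/

/-- A decreasing majorant of `r ↦ |H_0^{(1)}(kr)|`. -/
noncomputable def hankelMajorantZero (k r : ℝ) : ℝ :=
  min (1 + 2 / Real.pi * |Real.log (k * r / 2) + Real.eulerMascheroniConstant|)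
    (√(2 / (Real.pi * (k * r))))

/-- A decreasing majorant of `r ↦ |H_1^{(1)}(kr)|`. -/
noncomputable def hankelMajorantOne (k r : ℝ) : ℝ :=
  √(2 / (Real.pi * (k * r)) + 4 / (Real.pi ^ 2 * (k * r) ^ 2))

theorem norm_hankel1_zero_le {k r : ℝ} (hk : 0 < k) (hr : 0 < r) :
    ‖hankel1 0 (k * r)‖ ≤ hankelMajorantZero k r :=
  le_min (norm_hankel1_zero_le_log (mul_pos hk hr)) (norm_hankel1_zero_le_sqrt (mul_pos hk hr))

theorem hankelMajorantZero_nonneg (k r : ℝ) : 0 ≤ hankelMajorantZero k r :=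
  le_min (by have := Real.pi_pos; positivity) (Real.sqrt_nonneg _)

theorem hankelMajorantOne_nonneg (k r : ℝ) : 0 ≤ hankelMajorantOne k r := Real.sqrt_nonneg _

theorem hankelMajorantOne_antitoneOn {k : ℝ} (hk : 0 < k) :
    AntitoneOn (hankelMajorantOne k) (Set.Ioi 0) := fun r hr s _ hrs => by
  have hr : 0 < r := hr
  have := Real.pi_pos
  unfold hankelMajorantOne
  gcongr

/-- The logarithmic bound alone increases once `log(kr/2) + γ > 0`. It always is at least `1`, and
the square root is at most `1` from `kr = 2/π` on; up to there `log(kr/2) ≤ -1 < -γ`, so the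
logarithmic bound still decreases. -/
theorem hankelMajorantZero_antitoneOn {k : ℝ} (hk : 0 < k) :
    AntitoneOn (hankelMajorantZero k) (Set.Ioi 0) := fun r hr s hs hrs => by
  have hr : 0 < r := hr
  have hs : 0 < s := hs
  have hpi := Real.pi_pos
  refine le_min ?_ ((min_le_right _ _).trans (by gcongr))
  rcases le_total (2 / Real.pi) (k * s) with h | h
  · refine (min_le_right _ _).trans ?_
    have h1 : √(2 / (Real.pi * (k * s))) ≤ 1 := by
      refine Real.sqrt_le_one.mpr ?_
      rw [div_le_one (by positivity)]
      rwa [div_le_iff₀' hpi] at h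
    have : 0 ≤ 2 / Real.pi * |Real.log (k * r / 2) + Real.eulerMascheroniConstant| := by positivity
    linarith
  · refine (min_le_left _ _).trans ?_
    have hlog : Real.log (k * r / 2) ≤ Real.log (k * s / 2) :=
      Real.log_le_log (by positivity) (by gcongr)
    have hneg : Real.log (k * s / 2) ≤ -1 := by
      rw [Real.log_le_iff_le_exp (by positivity), Real.exp_neg]
      calc k * s / 2 ≤ 2 / Real.pi / 2 := by gcongr
        _ = Real.pi⁻¹ := by field_simp
        _ ≤ (Real.exp 1)⁻¹ := by
          gcongr
          have := Real.exp_one_lt_d9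
          have := Real.pi_gt_d2
          linarith
    have hγ := Real.eulerMascheroniConstant_lt_two_thirds
    rw [abs_of_neg (by linarith), abs_of_neg (by linarith)]
    gcongr

theorem measurable_hankelMajorantZero (k : ℝ) : Measurable (hankelMajorantZero k) := by
  unfold hankelMajorantZero
  fun_prop

/-! ### Radial integrals in the plane -/

/-- Bathtub principle: `Ω \ B` has no more volume than `B \ Ω`, and `φ` is at most `φ ρ` on the
former and at least `φ ρ` on the latter, apart from the centre. -/
theorem setLIntegral_dist_le_closedBall {φ : ℝ → ENNReal} (hφ : AntitoneOn φ (Set.Ioi 0))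
    {ρ : ℝ} (hρ : 0 < ρ) (x : EuclideanSpace ℝ (Fin 2)) {Ω : Set (EuclideanSpace ℝ (Fin 2))}
    (hΩ : MeasurableSet Ω) (hvol : volume Ω ≤ volume (Metric.closedBall x ρ)) :
    ∫⁻ y in Ω, φ (dist x y) ≤ ∫⁻ y in Metric.closedBall x ρ, φ (dist x y) := by
  set B := Metric.closedBall x ρ
  have hB : MeasurableSet B := Metric.isClosed_closedBall.measurableSet
  have hBfin : volume B ≠ ⊤ := measure_closedBall_lt_top.ne
  rw [← lintegral_inter_add_sdiff _ Ω hB, ← lintegral_inter_add_sdiff _ B hΩ, Set.inter_comm B Ω]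
  gcongr 1
  have h1 : volume (Ω \ B) ≤ volume (B \ Ω) := by
    rw [← measure_inter_add_sdiff Ω hB, ← measure_inter_add_sdiff B hΩ, Set.inter_comm B Ω] at hvol
    exact (ENNReal.add_le_add_iff_left
      (measure_ne_top_of_subset Set.inter_subset_right hBfin)).1 hvol
  calc ∫⁻ y in Ω \ B, φ (dist x y) ≤ ∫⁻ _ in Ω \ B, φ ρ := by
        refine setLIntegral_mono' (hΩ.diff hB) fun y hy => ?_
        have : ρ < dist x y := by
          have := hy.2
          rwa [Metric.mem_closedBall, dist_comm, not_le] at this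
        exact hφ hρ (hρ.trans this) this.le
    _ = φ ρ * volume (Ω \ B) := setLIntegral_const _ _
    _ ≤ φ ρ * volume (B \ Ω) := by gcongr
    _ = ∫⁻ _ in B \ Ω, φ ρ := (setLIntegral_const _ _).symm
    _ ≤ ∫⁻ y in B \ Ω, φ (dist x y) := by
        refine setLIntegral_mono_ae' (hB.diff hΩ) ?_
        -- Monotonicity is known only for positive distances, so the null set `{x}` is discarded.
        filter_upwards [Measure.ae_ne volume x] with y hy hyB
        have h2 : dist x y ≤ ρ := by
          have := hyB.1
          rwa [Metric.mem_closedBall, dist_comm] at this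
        exact hφ (dist_pos.2 hy.symm) hρ h2

theorem setLIntegral_closedBall_radial {f : ℝ → ℝ} (hf : ∀ r, 0 ≤ f r) {ρ : ℝ} (hρ : 0 < ρ)
    (hint : IntervalIntegrable (fun r => r * f r) volume 0 ρ) (x : EuclideanSpace ℝ (Fin 2)) :
    ∫⁻ y in Metric.closedBall x ρ, ENNReal.ofReal (f (dist x y)) =
      ENNReal.ofReal (2 * Real.pi * ∫ r in (0 : ℝ)..ρ, r * f r) := by
  let F : ℝ → ℝ := (Set.Iic ρ).indicator f
  have hF : ∀ r, 0 ≤ F r := fun r => Set.indicator_nonneg (fun r _ => hf r) r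
  have h1 : ∫⁻ y in Metric.closedBall x ρ, ENNReal.ofReal (f (dist x y)) =
      ∫⁻ y : EuclideanSpace ℝ (Fin 2), ENNReal.ofReal (F ‖y‖) := by
    rw [← lintegral_indicator Metric.isClosed_closedBall.measurableSet,
      ← lintegral_sub_right_eq_self (fun y => ENNReal.ofReal (F ‖y‖)) x]
    refine lintegral_congr fun y => ?_
    simp only [F, Set.indicator, Metric.mem_closedBall, Set.mem_Iic, dist_comm x y,
      dist_eq_norm y x]
    split_ifs <;> simp
  have hrF : (fun r => r * F r) = (Set.Iic ρ).indicator fun r => r * f r := by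
    funext r
    by_cases h : r ≤ ρ <;> simp [F, h]
  have hIoc : Set.Iic ρ ∩ Set.Ioi 0 = Set.Ioc 0 ρ := by
    ext r; simp [and_comm]
  have hFint : IntegrableOn (fun r => r * F r) (Set.Ioi 0) := by
    rw [hrF, IntegrableOn, integrable_indicator_iff measurableSet_Iic, IntegrableOn,
      Measure.restrict_restrict measurableSet_Iic, hIoc]
    exact (intervalIntegrable_iff_integrableOn_Ioc_of_le hρ.le).1 hint
  have hI : Integrable (fun y : EuclideanSpace ℝ (Fin 2) => F ‖y‖) := by
    rw [integrable_fun_norm_addHaar]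
    simpa using hFint
  rw [h1, ← ofReal_integral_eq_lintegral_ofReal hI (.of_forall fun y => hF _),
    integral_fun_norm_addHaar]
  congr 1
  have hv : volume.real (Metric.ball (0 : EuclideanSpace ℝ (Fin 2)) 1) = Real.pi := by
    rw [Measure.real, EuclideanSpace.volume_ball_fin_two]
    simp [Real.pi_pos.le]
  rw [hv, finrank_euclideanSpace_fin]
  simp only [smul_eq_mul, nsmul_eq_mul, Nat.add_one_sub_one, pow_one, Nat.cast_ofNat]
  rw [hrF, setIntegral_indicator measurableSet_Iic, Set.inter_comm, hIoc,
    intervalIntegral.integral_of_le hρ.le]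
  ring

/-! ### The one-dimensional integrals -/

theorem mul_hankelMajorantZero_le {k r : ℝ} (hk : 0 < k) (hr : 0 ≤ r) :
    r * hankelMajorantZero k r ≤ √(2 / (Real.pi * k)) * r ^ (1 / 2 : ℝ) := by
  have hpi := Real.pi_pos
  rcases hr.eq_or_lt with rfl | hr
  · simp
  · calc r * hankelMajorantZero k r ≤ r * √(2 / (Real.pi * (k * r))) := by
          gcongr; exact min_le_right _ _
      _ = √(2 / (Real.pi * k)) * r ^ (1 / 2 : ℝ) := by
        rw [← Real.sqrt_eq_rpow, ← Real.sqrt_mul (by positivity)]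
        nth_rw 1 [← Real.sqrt_sq hr.le]
        rw [← Real.sqrt_mul (by positivity)]
        congr 1
        field_simp

theorem intervalIntegrable_sqrt_bound (k a b : ℝ) : IntervalIntegrable
    (fun r : ℝ => √(2 / (Real.pi * k)) * r ^ (1 / 2 : ℝ)) volume a b :=
  (intervalIntegral.intervalIntegrable_rpow' (by norm_num)).const_mul _

theorem intervalIntegrable_mul_hankelMajorantZero {k a b : ℝ} (hk : 0 < k) (ha : 0 ≤ a)
    (hab : a ≤ b) : IntervalIntegrable (fun r => r * hankelMajorantZero k r) volume a b := by
  refine (intervalIntegrable_sqrt_bound k a b).mono_fun' ?_ ?_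
  · exact (measurable_id.mul (measurable_hankelMajorantZero k)).aestronglyMeasurable
  · refine (ae_restrict_iff' measurableSet_uIoc).2 (.of_forall fun r hr => ?_)
    rw [Set.uIoc_of_le hab] at hr
    have hr0 : 0 ≤ r := ha.trans hr.1.le
    beta_reduce
    rw [Real.norm_of_nonneg (mul_nonneg hr0 (hankelMajorantZero_nonneg k r))]
    exact mul_hankelMajorantZero_le hk hr0

theorem integral_mul_add_mul_log (c : ℝ) {a b : ℝ} (ha : 0 ≤ a) (hab : a ≤ b) :
    ∫ r in a..b, (c * r + r * Real.log r) =
      (c * b ^ 2 / 2 + b * (b * Real.log b) / 2 - b ^ 2 / 4) -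
        (c * a ^ 2 / 2 + a * (a * Real.log a) / 2 - a ^ 2 / 4) := by
  have hlog := Real.continuous_mul_log
  refine intervalIntegral.integral_eq_sub_of_hasDerivAt_of_le hab
    -- Written with `r * log r` as a factor so that the primitive is visibly continuous at `0`.
    (f := fun r => c * r ^ 2 / 2 + r * (r * Real.log r) / 2 - r ^ 2 / 4) ?_ (fun r hr => ?_) ?_
  · exact Continuous.continuousOn (by fun_prop)
  · have hr : 0 < r := ha.trans_lt hr.1
    have h := (((hasDerivAt_pow 2 r).const_mul c).div_const 2).add
      (((hasDerivAt_id r).mul ((hasDerivAt_id r).mul (Real.hasDerivAt_log hr.ne'))).div_const 2)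
      |>.sub ((hasDerivAt_pow 2 r).div_const 4)
    refine h.congr_deriv ?_
    simp
    field_simp
    ring
  · exact Continuous.intervalIntegrable (by fun_prop) _ _

theorem integral_abs_mul_add_mul_log_of_nonpos {c : ℝ} (hc : c ≤ 0) :
    ∫ r in (0 : ℝ)..1, |c * r + r * Real.log r| = 1 / 4 - c / 2 := by
  have h : ∫ r in (0 : ℝ)..1, |c * r + r * Real.log r| =
      ∫ r in (0 : ℝ)..1, -(c * r + r * Real.log r) := by
    refine intervalIntegral.integral_congr fun r hr => ?_
    rw [Set.uIcc_of_le zero_le_one] at hr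
    refine abs_of_nonpos ?_
    nlinarith [Real.log_nonpos hr.1 hr.2, hr.1]
  rw [h, intervalIntegral.integral_neg, integral_mul_add_mul_log c le_rfl zero_le_one]
  simp

/-- The integrand changes sign at `r = e^{-c}`, which lies in `(0, 1]` because `c ≥ 0`. -/
theorem integral_abs_mul_add_mul_log_of_nonneg {c : ℝ} (hc : 0 ≤ c) :
    ∫ r in (0 : ℝ)..1, |c * r + r * Real.log r| =
      c / 2 - 1 / 4 + Real.exp (-2 * c) / 2 := by
  have hlog := Real.continuous_mul_log
  have h0 : 0 < Real.exp (-c) := Real.exp_pos _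
  have h1 : Real.exp (-c) ≤ 1 := Real.exp_le_one_iff.2 (by linarith)
  have hcont : Continuous fun r : ℝ => |c * r + r * Real.log r| := by fun_prop
  have ha : ∫ r in (0 : ℝ)..Real.exp (-c), |c * r + r * Real.log r| =
      ∫ r in (0 : ℝ)..Real.exp (-c), -(c * r + r * Real.log r) := by
    refine intervalIntegral.integral_congr fun r hr => ?_
    rw [Set.uIcc_of_le h0.le] at hr
    refine abs_of_nonpos ?_
    rcases hr.1.eq_or_lt with h | h
    · simp [← h]
    · have := (Real.log_le_iff_le_exp h).2 hr.2
      nlinarith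
  have hb : ∫ r in Real.exp (-c)..1, |c * r + r * Real.log r| =
      ∫ r in Real.exp (-c)..1, (c * r + r * Real.log r) := by
    refine intervalIntegral.integral_congr fun r hr => ?_
    rw [Set.uIcc_of_le h1] at hr
    refine abs_of_nonneg ?_
    have hr0 := h0.trans_le hr.1
    have := (Real.le_log_iff_exp_le hr0).2 hr.1
    nlinarith
  rw [← intervalIntegral.integral_add_adjacent_intervals (hcont.intervalIntegrable _ _)
    (hcont.intervalIntegrable _ _) (b := Real.exp (-c)), ha, hb, intervalIntegral.integral_neg,
    integral_mul_add_mul_log c le_rfl h0.le, integral_mul_add_mul_log c h0.le h1, Real.log_exp,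
    show -2 * c = -c + -c by ring, Real.exp_add]
  simp
  ring

/-- The two cases of `termI` are the two signs of `c = log(k/2) + γ`: the threshold `2e^{-γ}` is
where `c` vanishes. -/
theorem pi_add_integral_abs_log_eq_termI {k : ℝ} (hk : 0 < k) : Real.pi + 4 * ∫ r in (0 : ℝ)..1,
    |(Real.log (k / 2) + Real.eulerMascheroniConstant) * r + r * Real.log r| = termI k := by
  have hiff : 2 * Real.exp (-Real.eulerMascheroniConstant) ≤ k ↔
      0 ≤ Real.log (k / 2) + Real.eulerMascheroniConstant := by
    rw [← neg_le_iff_add_nonneg, Real.le_log_iff_exp_le (by positivity),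
      le_div_iff₀ two_pos, mul_comm]
  rw [termI]
  split_ifs with h
  · rw [integral_abs_mul_add_mul_log_of_nonneg (hiff.1 h)]
    have : Real.exp (-2 * (Real.log (k / 2) + Real.eulerMascheroniConstant)) =
        4 / k ^ 2 * Real.exp (-2 * Real.eulerMascheroniConstant) := by
      rw [mul_add, Real.exp_add, show -2 * Real.log (k / 2) = -(Real.log (k / 2) +
        Real.log (k / 2)) by ring, Real.exp_neg, Real.exp_add, Real.exp_log (by positivity)]
      field_simp
      norm_num
    rw [this]
    ring
  · rw [integral_abs_mul_add_mul_log_of_nonpos (not_le.1 (mt hiff.2 h)).le]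
    ring

theorem two_pi_mul_integral_hankelMajorantZero_le {k R : ℝ} (hk : 0 < k) (hR : 1 < R) :
    2 * Real.pi * ∫ r in (0 : ℝ)..R, r * hankelMajorantZero k r ≤ termI k + termH0 k R := by
  have hpi := Real.pi_pos
  have hlog := Real.continuous_mul_log
  set c := Real.log (k / 2) + Real.eulerMascheroniConstant with hc
  have i1 := intervalIntegrable_mul_hankelMajorantZero hk le_rfl zero_le_one
  have i2 := intervalIntegrable_mul_hankelMajorantZero hk zero_le_one hR.le
  have hcont : Continuous fun r : ℝ => |c * r + r * Real.log r| := by fun_prop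
  have h1 : ∫ r in (0 : ℝ)..1, r * hankelMajorantZero k r ≤
      ∫ r in (0 : ℝ)..1, (r + 2 / Real.pi * |c * r + r * Real.log r|) := by
    refine intervalIntegral.integral_mono_on zero_le_one i1
      (Continuous.intervalIntegrable (by fun_prop) _ _) fun r hr => ?_
    rcases hr.1.eq_or_lt with rfl | hr0
    · simp
    · calc r * hankelMajorantZero k r ≤ r * (1 + 2 / Real.pi *
            |Real.log (k * r / 2) + Real.eulerMascheroniConstant|) := by
            gcongr; exact min_le_left _ _
        _ = r + 2 / Real.pi * |c * r + r * Real.log r| := by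
          rw [show c * r + r * Real.log r = r * (Real.log (k * r / 2) +
            Real.eulerMascheroniConstant) by
            rw [mul_div_right_comm, Real.log_mul (by positivity) hr0.ne', hc]; ring, abs_mul,
            abs_of_pos hr0]
          ring
  have h2 : ∫ r in (1 : ℝ)..R, r * hankelMajorantZero k r ≤
      ∫ r in (1 : ℝ)..R, √(2 / (Real.pi * k)) * r ^ (1 / 2 : ℝ) :=
    intervalIntegral.integral_mono_on hR.le i2 (intervalIntegrable_sqrt_bound k 1 R)
      fun r hr => mul_hankelMajorantZero_le hk (zero_le_one.trans hr.1)
  rw [intervalIntegral.integral_add (f := fun r => r) (continuous_id.intervalIntegrable _ _)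
    ((hcont.intervalIntegrable _ _).const_mul _), intervalIntegral.integral_const_mul,
    integral_id] at h1
  rw [intervalIntegral.integral_const_mul, integral_rpow (.inl (by norm_num))] at h2
  rw [← intervalIntegral.integral_add_adjacent_intervals i1 i2,
    ← pi_add_integral_abs_log_eq_termI hk, mul_add]
  refine add_le_add ?_ ?_
  · refine (mul_le_mul_of_nonneg_left h1 (by positivity)).trans (le_of_eq ?_)
    rw [← hc]
    field_simp
    ring
  · refine (mul_le_mul_of_nonneg_left h2 (by positivity)).trans (le_of_eq ?_)
    have hs : Real.pi * √(2 / (Real.pi * k)) = √(2 * Real.pi / k) := by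
      nth_rw 1 [← Real.sqrt_sq hpi.le]
      rw [← Real.sqrt_mul (by positivity)]
      congr 1
      field_simp
    rw [termH0, ← hs, Real.one_rpow]
    norm_num
    ring

theorem mul_hankelMajorantOne_eq {k r : ℝ} (hk : 0 < k) (hr : 0 < r) :
    r * hankelMajorantOne k r =
      √(2 / (Real.pi * k) * r + 4 / (Real.pi ^ 2 * k ^ 2)) := by
  have hpi := Real.pi_pos
  rw [hankelMajorantOne]
  nth_rw 1 [← Real.sqrt_sq hr.le]
  rw [← Real.sqrt_mul (by positivity)]
  congr 1
  field_simp

theorem intervalIntegrable_mul_hankelMajorantOne {k ρ : ℝ} (hk : 0 < k) (hρ : 0 < ρ) :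
    IntervalIntegrable (fun r => r * hankelMajorantOne k r) volume 0 ρ := by
  refine ((by fun_prop : Continuous fun r : ℝ => √(2 / (Real.pi * k) * r +
    4 / (Real.pi ^ 2 * k ^ 2))).intervalIntegrable 0 ρ).congr fun r hr => ?_
  rw [Set.uIoc_of_le hρ.le] at hr
  exact (mul_hankelMajorantOne_eq hk hr.1).symm

theorem four_div_rpow {k : ℝ} (hk : 0 < k) :
    (4 / (Real.pi ^ 2 * k ^ 2)) ^ (3 / 2 : ℝ) = (2 / (k * Real.pi)) ^ 3 := by
  have hpi := Real.pi_pos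
  rw [show 4 / (Real.pi ^ 2 * k ^ 2) = (2 / (k * Real.pi)) ^ (2 : ℝ) by
    rw [Real.rpow_two]; field_simp; norm_num, ← Real.rpow_mul (by positivity),
    ← Real.rpow_natCast]
  norm_num

theorem two_pi_mul_integral_hankelMajorantOne {k ρ : ℝ} (hk : 0 < k) (hρ : 0 < ρ) :
    2 * Real.pi * ∫ r in (0 : ℝ)..ρ, r * hankelMajorantOne k r = termH1 k ρ := by
  have hpi := Real.pi_pos
  have h : ∫ r in (0 : ℝ)..ρ, r * hankelMajorantOne k r =
      ∫ r in (0 : ℝ)..ρ, √(2 / (Real.pi * k) * r + 4 / (Real.pi ^ 2 * k ^ 2)) := by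
    refine intervalIntegral.integral_congr_ae (.of_forall fun r hr => ?_)
    rw [Set.uIoc_of_le hρ.le] at hr
    exact mul_hankelMajorantOne_eq hk hr.1
  rw [h, intervalIntegral.integral_eq_sub_of_hasDerivAt (f := fun r => Real.pi * k / 3 *
    (2 / (Real.pi * k) * r + 4 / (Real.pi ^ 2 * k ^ 2)) ^ (3 / 2 : ℝ)) (fun r hr => ?_)
    (Continuous.intervalIntegrable (by fun_prop) _ _)]
  · rw [mul_zero, zero_add, four_div_rpow hk, termH1]
    ring
  · rw [Set.uIcc_of_le hρ.le] at hr
    have hr := hr.1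
    have h1 := (((hasDerivAt_id r).const_mul (2 / (Real.pi * k))).add_const
      (4 / (Real.pi ^ 2 * k ^ 2))).rpow_const (p := 3 / 2) (.inl (by simp only [id]; positivity))
    refine (h1.const_mul (Real.pi * k / 3)).congr_deriv ?_
    rw [Real.sqrt_eq_rpow]
    norm_num
    field_simp

/-- Convexity of `x ↦ x^{3/2}` between the arguments for radii `R` and `0`, with weight `1/√2`;
`termH1` vanishes at radius `0`. -/
theorem sqrt_two_mul_termH1_le {k R : ℝ} (hk : 0 < k) (hR : 0 < R) :
    √2 * termH1 k (R / √2) ≤ termH1 k R := by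
  have hpi := Real.pi_pos
  have h2 : 0 < √2 := by positivity
  have hinv : (√2)⁻¹ ≤ 1 := inv_le_one_of_one_le₀ (Real.one_le_sqrt.2 one_le_two)
  have hconv : ConvexOn ℝ (Set.Ici 0) fun x : ℝ => x ^ (3 / 2 : ℝ) :=
    convexOn_rpow (by norm_num)
  have h := hconv.2
    (show 2 / (Real.pi * k) * R + 4 / (Real.pi ^ 2 * k ^ 2) ∈ Set.Ici 0 from
      Set.mem_Ici.2 (by positivity))
    (show 4 / (Real.pi ^ 2 * k ^ 2) ∈ Set.Ici 0 from Set.mem_Ici.2 (by positivity))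
    (show 0 ≤ (√2)⁻¹ by positivity) (sub_nonneg.2 hinv) (add_sub_cancel _ _)
  simp only [smul_eq_mul] at h
  rw [four_div_rpow hk] at h
  rw [show (√2)⁻¹ * (2 / (Real.pi * k) * R + 4 / (Real.pi ^ 2 * k ^ 2)) + (1 - (√2)⁻¹) *
    (4 / (Real.pi ^ 2 * k ^ 2)) = 2 / (Real.pi * k) * (R / √2) + 4 / (Real.pi ^ 2 * k ^ 2) by
    ring] at h
  rw [termH1, termH1]
  calc _ ≤ √2 * (2 * Real.pi ^ 2 * k / 3 * ((√2)⁻¹ * (2 / (Real.pi * k) * R +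
        4 / (Real.pi ^ 2 * k ^ 2)) ^ (3 / 2 : ℝ) + (1 - (√2)⁻¹) * (2 / (k * Real.pi)) ^ 3 -
        (2 / (k * Real.pi)) ^ 3)) := by gcongr
    _ = _ := by field_simp; ring

/-! ### The Green's function -/

theorem abs_add_abs_le_sqrt_two {u v : ℝ} (h : u ^ 2 + v ^ 2 = 1) : |u| + |v| ≤ √2 := by
  refine Real.le_sqrt_of_sq_le ?_
  nlinarith [sq_nonneg (|u| - |v|), sq_abs u, sq_abs v]

theorem enorm_add_enorm_le {c : ℝ} (hc : 0 ≤ c) {a b h : ℂ} {u v α β : ℝ}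
    (huv : u ^ 2 + v ^ 2 = 1) (hα : ‖a‖ ≤ α) (hβ : ‖h‖ ≤ β) (hb : ‖b‖ ≤ c * (‖a‖ + ‖h‖ * |u|)) :
    ‖b‖ₑ + ‖(c : ℂ) * (h * (v : ℂ))‖ₑ ≤ ENNReal.ofReal (c * α) + ENNReal.ofReal (c * (√2 * β)) := by
  have hα0 : 0 ≤ α := (norm_nonneg _).trans hα
  have hβ0 : 0 ≤ β := (norm_nonneg _).trans hβ
  rw [← ofReal_norm, ← ofReal_norm, ← ENNReal.ofReal_add (norm_nonneg _)
    (norm_nonneg _), ← ENNReal.ofReal_add (by positivity) (by positivity)]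
  refine ENNReal.ofReal_le_ofReal ?_
  rw [norm_mul, norm_mul, Complex.norm_real, Complex.norm_real, Real.norm_of_nonneg hc,
    Real.norm_eq_abs]
  have h1 := abs_add_abs_le_sqrt_two huv
  calc ‖b‖ + c * (‖h‖ * |v|) ≤ c * (‖a‖ + ‖h‖ * |u|) + c * (‖h‖ * |v|) := by gcongr
    _ = c * ‖a‖ + c * ((|u| + |v|) * ‖h‖) := by ring
    _ ≤ c * α + c * (√2 * β) := by gcongr

theorem matrixOneNorm_diracGreen_le {k : ℝ} (hk : 0 < k) {x y : EuclideanSpace ℝ (Fin 2)}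
    (hxy : x ≠ y) : matrixOneNorm (diracGreen k x y) ≤
      ENNReal.ofReal (k / 4 * hankelMajorantZero k (dist x y)) +
        ENNReal.ofReal (k / 4 * (√2 * hankelMajorantOne k (dist x y))) := by
  have hd : 0 < dist x y := dist_pos.2 hxy
  have hsq : ((x 0 - y 0) / dist x y) ^ 2 + ((x 1 - y 1) / dist x y) ^ 2 = 1 := by
    have h := EuclideanSpace.real_norm_sq_eq (x - y)
    rw [← dist_eq_norm, Fin.sum_univ_two] at h
    simp only [PiLp.sub_apply] at h
    rw [div_pow, div_pow, ← add_div, ← h, div_self (by positivity)]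
  have h0 := norm_hankel1_zero_le hk hd
  have h1 : ‖hankel1 1 (k * dist x y)‖ ≤ hankelMajorantOne k (dist x y) :=
    norm_hankel1_one_le (mul_pos hk hd)
  rw [diracGreen]
  generalize (x 0 - y 0) / dist x y = u at *
  generalize (x 1 - y 1) / dist x y = v at *
  generalize hankel1 0 (k * dist x y) = a at *
  generalize hankel1 1 (k * dist x y) = h at *
  -- The sign `s = ±1` treats both diagonal entries `i H₀ ± u H₁` at once.
  have hb : ∀ s : ℂ, ‖s‖ = 1 → ‖((k / 4 : ℝ) : ℂ) * (Complex.I * a + s * (h * (u : ℂ)))‖ ≤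
      k / 4 * (‖a‖ + ‖h‖ * |u|) := fun s hs => by
    rw [norm_mul, Complex.norm_real, Real.norm_of_nonneg (by positivity)]
    gcongr
    refine (norm_add_le _ _).trans (le_of_eq ?_)
    simp [hs]
  refine iSup_le fun j => ?_
  rw [Fin.sum_univ_two]
  fin_cases j
  · refine le_trans (le_of_eq ?_) (enorm_add_enorm_le (by positivity) hsq h0 h1 (hb 1 (by simp)))
    simp [pauliAlpha, pauliBeta]
  · refine le_trans (le_of_eq ?_) (enorm_add_enorm_le (by positivity) hsq h0 h1 (hb (-1) (by simp)))
    rw [add_comm]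
    simp [pauliAlpha, pauliBeta]

/-! ### From the area of `Ω` to the bound on `μ_a` -/

/-- The radii for `H₀` and `H₁` are kept separate: the first part needs a smaller disk only for the
`H₁` term. -/
theorem muA_le_of_volume_le {k R ρ : ℝ} (hk : 0 < k) (hR : 1 < R) (hρ : 0 < ρ)
    {Ω : Set (EuclideanSpace ℝ (Fin 2))} (hΩ : MeasurableSet Ω)
    (hvR : volume Ω ≤ ENNReal.ofReal R ^ 2 * ENNReal.ofReal Real.pi)
    (hvρ : volume Ω ≤ ENNReal.ofReal ρ ^ 2 * ENNReal.ofReal Real.pi) :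
    muA k Ω ≤ ENNReal.ofReal (k ^ 2 / 4 * (termI k + termH0 k R + √2 * termH1 k ρ)) := by
  have hpi := Real.pi_pos
  have hR0 : 0 < R := zero_lt_one.trans hR
  have hk4 : 0 ≤ k / 4 := by positivity
  have hanti : ∀ {f : ℝ → ℝ} {c : ℝ}, 0 ≤ c → AntitoneOn f (Set.Ioi 0) →
      AntitoneOn (fun r => ENNReal.ofReal (c * f r)) (Set.Ioi 0) := fun hc hf r hr s hs hrs =>
    ENNReal.ofReal_le_ofReal (mul_le_mul_of_nonneg_left (hf hr hs hrs) hc)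
  have key : ∀ x ∈ Ω, ∫⁻ y in Ω, matrixOneNorm (diracGreen k x y) ≤
      ENNReal.ofReal (k / 4 * (termI k + termH0 k R + √2 * termH1 k ρ)) := fun x _ => by
    have hzero : ∫⁻ y in Ω, ENNReal.ofReal (k / 4 * hankelMajorantZero k (dist x y)) ≤
        ENNReal.ofReal (k / 4 * (2 * Real.pi * ∫ r in (0 : ℝ)..R, r * hankelMajorantZero k r)) := by
      refine (setLIntegral_dist_le_closedBall (hanti hk4 (hankelMajorantZero_antitoneOn hk)) hR0 x
        hΩ (by rwa [EuclideanSpace.volume_closedBall_fin_two])).trans (le_of_eq ?_)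
      have hi := intervalIntegrable_mul_hankelMajorantZero hk le_rfl hR0.le
      have he : (fun r => r * (k / 4 * hankelMajorantZero k r)) =
        fun r => k / 4 * (r * hankelMajorantZero k r) := funext fun r => by ring
      rw [setLIntegral_closedBall_radial
        (fun r => mul_nonneg hk4 (hankelMajorantZero_nonneg k r)) hR0 (by
          rw [he]; exact hi.const_mul _), he, intervalIntegral.integral_const_mul]
      congr 1
      ring
    have hone : ∫⁻ y in Ω, ENNReal.ofReal (k / 4 * (√2 * hankelMajorantOne k (dist x y))) ≤
        ENNReal.ofReal (k / 4 * (√2 * termH1 k ρ)) := by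
      have h2 : 0 ≤ k / 4 * √2 := by positivity
      simp only [← mul_assoc (k / 4)]
      refine (setLIntegral_dist_le_closedBall (hanti h2 (hankelMajorantOne_antitoneOn hk)) hρ x
        hΩ (by rwa [EuclideanSpace.volume_closedBall_fin_two])).trans (le_of_eq ?_)
      have hi := intervalIntegrable_mul_hankelMajorantOne hk hρ
      have he : (fun r => r * (k / 4 * √2 * hankelMajorantOne k r)) =
        fun r => k / 4 * √2 * (r * hankelMajorantOne k r) := funext fun r => by ring
      rw [setLIntegral_closedBall_radial
        (fun r => mul_nonneg h2 (hankelMajorantOne_nonneg k r)) hρ (by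
          rw [he]; exact hi.const_mul _), he, intervalIntegral.integral_const_mul,
        ← two_pi_mul_integral_hankelMajorantOne hk hρ]
      congr 1
      ring
    have hI := two_pi_mul_integral_hankelMajorantZero_le hk hR
    have hI0 : 0 ≤ ∫ r in (0 : ℝ)..R, r * hankelMajorantZero k r :=
      intervalIntegral.integral_nonneg hR0.le fun r hr =>
        mul_nonneg hr.1 (hankelMajorantZero_nonneg k r)
    have hH0 : 0 ≤ termH1 k ρ := by
      rw [← two_pi_mul_integral_hankelMajorantOne hk hρ]
      exact mul_nonneg (by positivity) (intervalIntegral.integral_nonneg hρ.le fun r hr =>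
        mul_nonneg hr.1 (hankelMajorantOne_nonneg k r))
    have hm : Measurable fun y : EuclideanSpace ℝ (Fin 2) =>
        ENNReal.ofReal (k / 4 * hankelMajorantZero k (dist x y)) :=
      (((measurable_hankelMajorantZero k).comp (measurable_const.dist measurable_id)).const_mul
        _).ennreal_ofReal
    calc ∫⁻ y in Ω, matrixOneNorm (diracGreen k x y)
        ≤ ∫⁻ y in Ω, (ENNReal.ofReal (k / 4 * hankelMajorantZero k (dist x y)) +
            ENNReal.ofReal (k / 4 * (√2 * hankelMajorantOne k (dist x y)))) := by
          refine lintegral_mono_ae (ae_restrict_of_ae ?_)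
          filter_upwards [Measure.ae_ne volume x] with y hy
          exact matrixOneNorm_diracGreen_le hk hy.symm
      _ = _ := lintegral_add_left hm _
      _ ≤ _ := add_le_add hzero hone
      _ = _ := (ENNReal.ofReal_add (by positivity) (by positivity)).symm
      _ ≤ _ := ENNReal.ofReal_le_ofReal (by
          rw [← mul_add]
          gcongr)
  calc muA k Ω ≤ ENNReal.ofReal k *
        ENNReal.ofReal (k / 4 * (termI k + termH0 k R + √2 * termH1 k ρ)) := by
        unfold muA
        gcongr
        exact iSup₂_le key
    _ = _ := by
      rw [← ENNReal.ofReal_mul hk.le]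
      congr 1
      ring

/-- Each coordinate varies by at most `R` on `Ω`, which therefore lies in a square of side `R` with
corner at the coordinatewise infima. -/
theorem volume_le_sq_of_pairwise_dist_le {R : ℝ}
    {Ω : Set (EuclideanSpace ℝ (Fin 2))} (hd : ∀ x ∈ Ω, Ω ⊆ Metric.closedBall x R) :
    volume Ω ≤ ENNReal.ofReal R ^ 2 := by
  rcases Ω.eq_empty_or_nonempty with rfl | ⟨z, hz⟩
  · simp
  have hcoord : ∀ x ∈ Ω, ∀ y ∈ Ω, ∀ i, y i - R ≤ x i := fun x hx y hy i => by
    have h1 := hd x hx hy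
    rw [Metric.mem_closedBall, dist_eq_norm] at h1
    have h2 := (PiLp.norm_apply_le (y - x) i).trans h1
    rw [PiLp.sub_apply, Real.norm_eq_abs] at h2
    linarith [le_abs_self (y i - x i)]
  let m : Fin 2 → ℝ := fun i => sInf ((fun x : EuclideanSpace ℝ (Fin 2) => x i) '' Ω)
  have hsub : Ω ⊆ WithLp.ofLp ⁻¹' Set.Icc m (fun i => m i + R) := fun y hy => by
    refine ⟨fun i => csInf_le ⟨z i - R, ?_⟩ ⟨y, hy, rfl⟩, fun i => ?_⟩
    · rintro _ ⟨x, hx, rfl⟩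
      exact hcoord x hx z hz i
    · rw [← sub_le_iff_le_add]
      refine le_csInf ⟨_, ⟨z, hz, rfl⟩⟩ ?_
      rintro _ ⟨x, hx, rfl⟩
      exact hcoord x hx y hy i
  refine (measure_mono hsub).trans (le_of_eq ?_)
  rw [(PiLp.volume_preserving_ofLp (Fin 2)).measure_preimage
    measurableSet_Icc.nullMeasurableSet, Real.volume_Icc_pi]
  simp

theorem mainTheorem6 (k R : ℝ) (hk : 0 < k) (hR : 1 < R)
    (Ω : Set (EuclideanSpace ℝ (Fin 2))) (hΩ : MeasurableSet Ω) :
    ((∀ x ∈ Ω, Ω ⊆ Metric.closedBall x R) →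
      muA k Ω ≤ ENNReal.ofReal (k ^ 2 / 4 * (termI k + termH0 k R + termH1 k R))) ∧
    ((∃ c : EuclideanSpace ℝ (Fin 2), Ω ⊆ Metric.closedBall c R) →
      muA k Ω ≤
        ENNReal.ofReal (k ^ 2 / 4 * (termI k + termH0 k R + Real.sqrt 2 * termH1 k R))) := by
  have hR0 : 0 < R := zero_lt_one.trans hR
  refine ⟨fun hd => ?_, fun ⟨c, hc⟩ => ?_⟩
  · have hvol := volume_le_sq_of_pairwise_dist_le hd
    -- With radius `R/√2` for `H₁` the disk has area `πR²/2 ≥ R²`, and the rescaling cancels the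
    -- factor `√2`.
    refine (muA_le_of_volume_le hk hR (div_pos hR0 (Real.sqrt_pos.2 two_pos)) hΩ
      (hvol.trans ?_) (hvol.trans ?_)).trans (ENNReal.ofReal_le_ofReal ?_)
    · refine le_mul_of_one_le_right' ?_
      rw [ENNReal.one_le_ofReal]
      linarith [Real.pi_gt_three]
    · rw [← ENNReal.ofReal_pow hR0.le, ← ENNReal.ofReal_pow (by positivity),
        ← ENNReal.ofReal_mul (by positivity)]
      refine ENNReal.ofReal_le_ofReal ?_
      rw [div_pow, Real.sq_sqrt zero_le_two]
      nlinarith [Real.pi_gt_three, sq_nonneg R]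
    · have := sqrt_two_mul_termH1_le hk hR0
      gcongr
  · have hvol : volume Ω ≤ ENNReal.ofReal R ^ 2 * ENNReal.ofReal Real.pi := by
      rw [← EuclideanSpace.volume_closedBall_fin_two c]
      exact measure_mono hc
    exact muA_le_of_volume_le hk hR hR0 hΩ hvol hvol
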